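/- For $z,w$ in the open unit disc $\mathbb D$ let $\rho(z,w)=\frac{|z-w|}{|1-\bar z w|}$, and for nonempty $S\subset\mathbb D$ let $\rho(z,S)=\inf_{w\in S}\rho(z,w)$. Let $U$ be an inner function in $\mathbb D$ (analytic, $|U|\le 1$, with radial limits of modulus $1$ almost everywhere on the unit circle), and let $Z(U)$ be its zero set in $\mathbb D$. Assume that $U$ is a generalized Carleson–Newman inner function, with lower bound $\psi$: that is, $\psi:(0,1)\to(0,1)$ is an increasing (not necessarily strictly) function such that $$|U(z)|\ge\psi\bigl(\rho(z,Z(U))\bigr)\qquad\text{for all } z\in\mathbb D\setminus Z(U);$$ if $Z(U)=\emptyset$, this condition is understood as $|U(z)|\ge\psi(t)$ for all $z\in\mathbb D$ and all $t\in(0,1)$. Let $\gamma\in\mathbb C$ with $0<|\gamma|<\sup_{0<t<1}\psi(t)$. Then the Frostman shift $$U_\gamma=\varphi_\gamma\circ U,\qquad \varphi_\gamma(\zeta)=\frac{\gamma-\zeta}{1-\bar\gamma\zeta},$$ is a Carleson–Newman Blaschke product, that is, a product of finitely many interpolating Blaschke products. Here a Blaschke product may carry a unimodular constant factor and may have finitely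 many zeros or none, and it is called interpolating if its zeros are distinct and every bounded function on its zero set is the restriction of a bounded analytic function in $\mathbb D$. -/

import Mathlib

namespace CarlesonNewman

noncomputable section

/-- `f` belongs to `H^∞`: it is analytic and bounded in the open unit disc. -/
def IsHInfty (f : ℂ → ℂ) : Prop :=
  DifferentiableOn ℂ f (Metric.ball 0 1) ∧ ∃ C : ℝ, ∀ z ∈ Metric.ball (0 : ℂ) 1, ‖f z‖ ≤ C

/-- An inner function: analytic in the open unit disc, bounded by `1` there, with radial limits of
modulus `1` at almost every point of the unit circle. -/
structure IsInner (U : ℂ → ℂ) : Prop where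
  differentiableOn : DifferentiableOn ℂ U (Metric.ball 0 1)
  norm_le_one : ∀ z ∈ Metric.ball (0 : ℂ) 1, ‖U z‖ ≤ 1
  radial_limit : ∀ᵐ θ : ℝ, ∃ l : ℂ, ‖l‖ = 1 ∧
    Filter.Tendsto (fun r : ℝ => U (r * Complex.exp (θ * Complex.I)))
      (nhdsWithin 1 (Set.Iio 1)) (nhds l)

/-- The zero set `Z(U)` of `U` in the open unit disc. -/
def zeroSet (U : ℂ → ℂ) : Set ℂ :=
  {z | z ∈ Metric.ball (0 : ℂ) 1 ∧ U z = 0}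

/-- The pseudo-hyperbolic distance `ρ(z, w)` in the unit disc. -/
def rho (z w : ℂ) : ℝ :=
  ‖z - w‖ / ‖1 - (starRingEnd ℂ) z * w‖

/-- The pseudo-hyperbolic distance `ρ(z, S)` from a point to a nonempty set (used only for
nonempty `S`). -/
def rhoSet (z : ℂ) (S : Set ℂ) : ℝ :=
  sInf (rho z '' S)

/-- `ψ : (0,1) → (0,1)` is an increasing function with `|U(z)| ≥ ψ(ρ(z, Z(U)))` in the unit disc.
There is no requirement where `ρ(z, Z(U)) = 0`. When `Z(U)` is empty, the distance to it is larger
than any `t < 1`, and the requirement is `|U(z)| ≥ ψ(t)` for all `t ∈ (0,1)`.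
`U` is a generalized Carleson-Newman function if and only if such a `ψ` exists. -/
structure IsLowerBound (U : ℂ → ℂ) (ψ : ℝ → ℝ) : Prop where
  mapsTo : Set.MapsTo ψ (Set.Ioo 0 1) (Set.Ioo 0 1)
  monotoneOn : MonotoneOn ψ (Set.Ioo 0 1)
  le_norm : (zeroSet U).Nonempty → ∀ z ∈ Metric.ball (0 : ℂ) 1,
    0 < rhoSet z (zeroSet U) → ψ (rhoSet z (zeroSet U)) ≤ ‖U z‖
  le_norm_of_empty : zeroSet U = ∅ → ∀ z ∈ Metric.ball (0 : ℂ) 1,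
    ∀ t ∈ Set.Ioo (0 : ℝ) 1, ψ t ≤ ‖U z‖

/-- The Möbius transformation `φ_w(z) = (w - z) / (1 - z * conj w)`. -/
def phi (w z : ℂ) : ℂ :=
  (w - z) / (1 - z * (starRingEnd ℂ) w)

/-- The normalized Blaschke factor with zero `a`. -/
def blaschkeFactor (a z : ℂ) : ℂ :=
  if a = 0 then z else (‖a‖ / a) * phi a z

/-- `B` is (on the unit disc) the Blaschke product with simple zeros precisely at the points of
`L`, up to a unimodular constant. The set `L` may be finite or empty. -/
def IsSimpleBlaschkeProduct (L : Set ℂ) (B : ℂ → ℂ) : Prop :=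
  L ⊆ Metric.ball 0 1 ∧ Summable (fun a : L => 1 - ‖(a : ℂ)‖) ∧
    ∃ c : ℂ, ‖c‖ = 1 ∧ ∀ z ∈ Metric.ball (0 : ℂ) 1,
      Multipliable (fun a : L => blaschkeFactor a z) ∧ B z = c * ∏' a : L, blaschkeFactor a z

/-- `L` is an interpolating set: every bounded function on `L` is the restriction of a function
in `H^∞`. -/
def IsInterpolating (L : Set ℂ) : Prop :=
  ∀ v : L → ℂ, (∃ C : ℝ, ∀ a, ‖v a‖ ≤ C) → ∃ f, IsHInfty f ∧ ∀ a : L, f a = v a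

/-- An interpolating Blaschke product: its zeros are distinct and form an interpolating set. -/
def IsInterpolatingBlaschkeProduct (B : ℂ → ℂ) : Prop :=
  ∃ L : Set ℂ, IsSimpleBlaschkeProduct L B ∧ IsInterpolating L

/-- A Carleson-Newman Blaschke product: on the unit disc, a product of finitely many interpolating
Blaschke products. -/
def IsCarlesonNewmanBlaschkeProduct (B : ℂ → ℂ) : Prop :=
  ∃ (N : ℕ) (b : Fin N → ℂ → ℂ), (∀ i, IsInterpolatingBlaschkeProduct (b i)) ∧
    ∀ z ∈ Metric.ball (0 : ℂ) 1, B z = ∏ i, b i z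

end

end CarlesonNewman

namespace CarlesonNewman

open Metric Set Filter Topology ComplexConjugate

/-! Choose `t` with `‖γ‖ < ψ t`. If a point lies within `t` of a zero of `U`, then `‖U_γ‖ = ‖γ‖` at
that zero. Otherwise `‖U‖ ≥ ψ t > ‖γ‖` at the point itself, which keeps `U_γ` away from `0` there.
Hence some `η > 0` is a lower bound for `‖U_γ‖` somewhere in every pseudo-hyperbolic disc of radius
`t`, and this alone makes a function `f` with unimodular radial limits a Carleson-Newman product
(`isCarlesonNewmanBlaschkeProduct_of_exists_le_norm`).

Let `a i` be the zeros of `f` with multiplicity. Where `‖f‖ ≥ η`, the bound `‖f‖ ≤ ∏ rho (a i)`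
controls `∑ (1 - rho ^ 2)` by `-2 log η`. Moving by a distance at most `t` costs a constant factor,
so the sum is bounded uniformly on the disc: the Carleson condition. At `0` it gives the Blaschke
condition, so `f = B * S` with `S` free of zeros.

The singular part is trivial: `‖S‖ ≥ ‖f‖`, so Harnack's inequality spreads the lower bound `η` over
the whole disc. Then `1 / S` is bounded, its radial limits have modulus `1`, and the mean value
property with the maximum principle makes `S` constant.

The Carleson condition also bounds the number of zeros within `1 / 2` of a given zero, so a
colouring splits the zeros into finitely many separated families. Each is interpolating by Jones'
formula (`exists_isHInfty_interpolating`). -/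

/-! ### Pseudo-hyperbolic geometry and Blaschke factors -/

theorem one_sub_conj_mul_ne_zero {z w : ℂ} (hz : ‖z‖ < 1) (hw : ‖w‖ ≤ 1) :
    1 - conj z * w ≠ 0 := by
  intro h
  have h1 : ‖conj z * w‖ = 1 := by rw [← sub_eq_zero.mp h, norm_one]
  rw [norm_mul, RCLike.norm_conj] at h1
  nlinarith [norm_nonneg z, norm_nonneg w]

theorem norm_one_sub_conj_mul_sq (z w : ℂ) :
    ‖1 - conj z * w‖ ^ 2 = ‖z - w‖ ^ 2 + (1 - ‖z‖ ^ 2) * (1 - ‖w‖ ^ 2) := by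
  simp only [← Complex.normSq_eq_norm_sq, Complex.normSq_apply]
  simp
  ring

theorem norm_one_sub_conj_mul_comm (z w : ℂ) : ‖1 - conj z * w‖ = ‖1 - conj w * z‖ := by
  rw [← RCLike.norm_conj (1 - conj z * w)]
  simp [mul_comm]

theorem rho_nonneg (z w : ℂ) : 0 ≤ rho z w := by unfold rho; positivity

theorem rho_comm (z w : ℂ) : rho z w = rho w z := by
  unfold rho
  rw [norm_sub_rev, norm_one_sub_conj_mul_comm]

theorem one_sub_rho_sq {z w : ℂ} (hz : ‖z‖ < 1) (hw : ‖w‖ < 1) :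
    1 - rho z w ^ 2 = (1 - ‖z‖ ^ 2) * (1 - ‖w‖ ^ 2) / ‖1 - conj z * w‖ ^ 2 := by
  have h := norm_pos_iff.mpr (one_sub_conj_mul_ne_zero hz hw.le)
  unfold rho
  rw [div_pow, eq_div_iff (by positivity), sub_mul, div_mul_cancel₀ _ (by positivity),
    norm_one_sub_conj_mul_sq]
  ring

theorem one_sub_norm_sq_pos {z : ℂ} (hz : ‖z‖ < 1) : 0 < 1 - ‖z‖ ^ 2 := by
  nlinarith [norm_nonneg z]

theorem one_sub_rho_sq_pos {z w : ℂ} (hz : ‖z‖ < 1) (hw : ‖w‖ < 1) : 0 < 1 - rho z w ^ 2 := by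
  have h := norm_pos_iff.mpr (one_sub_conj_mul_ne_zero hz hw.le)
  have := one_sub_norm_sq_pos hz
  have := one_sub_norm_sq_pos hw
  rw [one_sub_rho_sq hz hw]
  positivity

theorem rho_lt_one {z w : ℂ} (hz : ‖z‖ < 1) (hw : ‖w‖ < 1) : rho z w < 1 := by
  nlinarith [one_sub_rho_sq_pos hz hw, rho_nonneg z w]

theorem rho_eq_zero_iff {z w : ℂ} (hz : ‖z‖ < 1) (hw : ‖w‖ < 1) : rho z w = 0 ↔ z = w := by
  have h := norm_ne_zero_iff.mpr (one_sub_conj_mul_ne_zero hz hw.le)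
  simp [rho, div_eq_zero_iff, h, sub_eq_zero]

theorem norm_phi (a z : ℂ) : ‖phi a z‖ = rho a z := by
  simp only [phi, rho, norm_div]
  rw [mul_comm]

theorem phi_phi {a z : ℂ} (ha : ‖a‖ < 1) (hz : ‖z‖ < 1) : phi a (phi a z) = z := by
  have h1 := one_sub_conj_mul_ne_zero ha hz.le
  have h2 := one_sub_conj_mul_ne_zero ha ha.le
  rw [mul_comm] at h1 h2
  have h3 : 1 - (a - z) / (1 - z * conj a) * conj a = (1 - a * conj a) / (1 - z * conj a) := by
    field_simp
    ring
  simp only [phi]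
  rw [h3]
  field_simp
  ring

theorem differentiableOn_phi {a : ℂ} (ha : ‖a‖ < 1) :
    DifferentiableOn ℂ (phi a) (closedBall 0 1) := by
  intro z hz
  have := one_sub_conj_mul_ne_zero ha (mem_closedBall_zero_iff.mp hz)
  rw [mul_comm] at this
  unfold phi
  apply DifferentiableAt.differentiableWithinAt
  fun_prop (disch := assumption)

theorem norm_phi_lt_one {a z : ℂ} (ha : ‖a‖ < 1) (hz : ‖z‖ < 1) : ‖phi a z‖ < 1 := by
  rw [norm_phi]
  exact rho_lt_one ha hz

theorem norm_phi_le_one {a z : ℂ} (ha : ‖a‖ < 1) (hz : ‖z‖ ≤ 1) : ‖phi a z‖ ≤ 1 := by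
  rw [norm_phi, rho]
  apply div_le_one_of_le₀ _ (norm_nonneg _)
  rw [← sq_le_sq₀ (norm_nonneg _) (norm_nonneg _), norm_one_sub_conj_mul_sq]
  have := one_sub_norm_sq_pos ha
  have : 0 ≤ 1 - ‖z‖ ^ 2 := by nlinarith [norm_nonneg z]
  nlinarith [mul_nonneg (one_sub_norm_sq_pos ha).le this]

theorem norm_phi_eq_one {a z : ℂ} (ha : ‖a‖ < 1) (hz : ‖z‖ = 1) : ‖phi a z‖ = 1 := by
  rw [norm_phi, rho]
  have h := norm_ne_zero_iff.mpr (one_sub_conj_mul_ne_zero ha hz.le)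
  rw [div_eq_one_iff_eq h, ← sq_eq_sq₀ (norm_nonneg _) (norm_nonneg _), norm_one_sub_conj_mul_sq,
    hz]
  ring

theorem norm_blaschkeFactor (a z : ℂ) : ‖blaschkeFactor a z‖ = rho a z := by
  unfold blaschkeFactor
  split_ifs with h
  · simp [h, rho]
  · rw [norm_mul, norm_phi]
    simp [h]

theorem differentiableOn_blaschkeFactor {a : ℂ} (ha : ‖a‖ < 1) :
    DifferentiableOn ℂ (blaschkeFactor a) (ball 0 1) := by
  unfold blaschkeFactor
  split_ifs
  · exact differentiableOn_id
  · exact ((differentiableOn_phi ha).mono ball_subset_closedBall).const_mul _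

theorem blaschkeFactor_eq_zero_iff {a z : ℂ} (ha : ‖a‖ < 1) (hz : ‖z‖ < 1) :
    blaschkeFactor a z = 0 ↔ a = z := by
  rw [← norm_eq_zero, norm_blaschkeFactor, rho_eq_zero_iff ha hz]

theorem norm_blaschkeFactor_le_one {a z : ℂ} (ha : ‖a‖ < 1) (hz : ‖z‖ < 1) :
    ‖blaschkeFactor a z‖ ≤ 1 := by
  rw [norm_blaschkeFactor]
  exact (rho_lt_one ha hz).le

theorem one_sub_norm_le_norm_one_sub_conj_mul {a z : ℂ} (ha : ‖a‖ ≤ 1) :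
    1 - ‖z‖ ≤ ‖1 - conj a * z‖ := by
  have h := norm_sub_norm_le 1 (conj a * z)
  rw [norm_one, norm_mul, RCLike.norm_conj] at h
  nlinarith [norm_nonneg z]

theorem norm_blaschkeFactor_sub_one_le {a z : ℂ} (ha : ‖a‖ < 1) (hz : ‖z‖ < 1) :
    ‖blaschkeFactor a z - 1‖ ≤ (1 - ‖a‖) * (2 / (1 - ‖z‖)) := by
  have hz' : 0 < 1 - ‖z‖ := by linarith
  unfold blaschkeFactor
  split_ifs with h
  · subst h
    calc ‖z - 1‖ ≤ ‖z‖ + ‖(1 : ℂ)‖ := norm_sub_le _ _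
      _ ≤ 2 := by rw [norm_one]; linarith
      _ ≤ (1 - ‖(0 : ℂ)‖) * (2 / (1 - ‖z‖)) := by
        rw [norm_zero, sub_zero, one_mul, le_div_iff₀ hz']
        nlinarith [norm_nonneg z]
  · have h1 := one_sub_conj_mul_ne_zero ha hz.le
    have ha0 : 0 < ‖a‖ := norm_pos_iff.mpr h
    have key : (‖a‖ / a) * phi a z - 1 = -((1 - ‖a‖) * ((a + ‖a‖ * z) / (a * (1 - conj a * z)))) := by
      have h2 : (‖a‖ : ℂ) ^ 2 = a * conj a := by
        rw [Complex.mul_conj, Complex.normSq_eq_norm_sq]; push_cast; rfl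
      rw [mul_comm] at h1
      unfold phi
      rw [mul_comm (conj a) z]
      field_simp
      linear_combination (-z) * h2
    have h3 := one_sub_norm_le_norm_one_sub_conj_mul (z := z) ha.le
    have h4 : ‖(1 : ℂ) - ‖a‖‖ = 1 - ‖a‖ := by
      rw [← Complex.ofReal_one, ← Complex.ofReal_sub, Complex.norm_real, Real.norm_of_nonneg]
      linarith
    rw [key, norm_neg, norm_mul, h4, norm_div, norm_mul]
    apply mul_le_mul_of_nonneg_left _ (by linarith)
    have h5 : ‖a + ‖a‖ * z‖ ≤ ‖a‖ * 2 := by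
      calc ‖a + ‖a‖ * z‖ ≤ ‖a‖ + ‖(‖a‖ : ℂ) * z‖ := norm_add_le _ _
        _ ≤ _ := by
          rw [norm_mul, Complex.norm_real, norm_norm]
          nlinarith
    rw [div_le_div_iff₀ (by positivity) hz']
    calc _ ≤ ‖a‖ * 2 * (1 - ‖z‖) := by gcongr
      _ ≤ ‖a‖ * 2 * ‖1 - conj a * z‖ := by gcongr
      _ = _ := by ring

/-- The Schwarz-Pick lemma for a function with a zero at `a`. -/
theorem norm_le_rho_of_eq_zero {q : ℂ → ℂ} (hq : DifferentiableOn ℂ q (ball 0 1))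
    (hq1 : ∀ z ∈ ball (0 : ℂ) 1, ‖q z‖ ≤ 1) {a z : ℂ} (ha : ‖a‖ < 1) (hz : ‖z‖ < 1)
    (hqa : q a = 0) : ‖q z‖ ≤ rho a z := by
  have hmap : MapsTo (phi a) (ball 0 1) (ball 0 1) := fun w hw =>
    mem_ball_zero_iff.mpr (norm_phi_lt_one ha (mem_ball_zero_iff.mp hw))
  have h1 : DifferentiableOn ℂ (q ∘ phi a) (ball 0 1) :=
    hq.comp ((differentiableOn_phi ha).mono ball_subset_closedBall) hmap
  have h2 := Complex.norm_le_norm_of_mapsTo_ball h1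
    (fun w hw => mem_closedBall_zero_iff.mpr (hq1 _ (hmap hw)))
    (by simp [phi, hqa]) (norm_phi_lt_one ha hz)
  rwa [Function.comp, phi_phi ha hz, norm_phi] at h2

/-- In the formula `one_sub_rho_sq`, replacing `z` by a point `w` within `t` changes both `1 - ‖z‖ ^
2` and `‖1 - conj z * a‖` by bounded factors. This carries the Carleson sum from good points to all
points. -/
theorem exists_one_sub_rho_sq_le {t : ℝ} (ht0 : 0 ≤ t) (ht : t < 1) :
    ∃ K : ℝ, 0 < K ∧ ∀ z w a : ℂ, ‖z‖ < 1 → ‖w‖ < 1 → ‖a‖ < 1 → rho z w ≤ t →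
      1 - rho z a ^ 2 ≤ K * (1 - rho w a ^ 2) := by
  have ht1 : 0 < 1 - t := by linarith
  have ht2 : 0 < 1 - t ^ 2 := by nlinarith
  refine ⟨(1 + 2 * t / (1 - t)) ^ 2 * (4 / (1 - t ^ 2)), by positivity, ?_⟩
  intro z w a hz hw ha h
  have hzw := norm_pos_iff.mpr (one_sub_conj_mul_ne_zero hz hw.le)
  have hza := norm_pos_iff.mpr (one_sub_conj_mul_ne_zero hz ha.le)
  have hwa := norm_pos_iff.mpr (one_sub_conj_mul_ne_zero hw ha.le)
  have pz := one_sub_norm_sq_pos hz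
  have pw := one_sub_norm_sq_pos hw
  have pa := one_sub_norm_sq_pos ha
  have h1 : ‖z - w‖ ≤ t * ‖1 - conj z * w‖ := (div_le_iff₀ hzw).mp h
  have h2 : ‖1 - conj z * w‖ ≤ (1 - ‖z‖ ^ 2) / (1 - t) := by
    have e : 1 - conj z * w = ((1 - ‖z‖ ^ 2 : ℝ) : ℂ) + conj z * (z - w) := by
      have := Complex.conj_mul' z
      push_cast
      linear_combination -this
    have : ‖1 - conj z * w‖ ≤ (1 - ‖z‖ ^ 2) + ‖z‖ * ‖z - w‖ := by
      rw [e]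
      refine (norm_add_le _ _).trans ?_
      rw [Complex.norm_real, Real.norm_of_nonneg pz.le, norm_mul, RCLike.norm_conj]
    rw [le_div_iff₀ ht1]
    nlinarith [norm_nonneg (z - w)]
  have h3 : (1 - ‖z‖ ^ 2) ≤ 2 * ‖1 - conj z * a‖ := by
    have := one_sub_norm_le_norm_one_sub_conj_mul (a := a) (z := z) ha.le
    rw [norm_one_sub_conj_mul_comm] at this
    nlinarith [norm_nonneg z]
  have h4 : ‖1 - conj w * a‖ ≤ (1 + 2 * t / (1 - t)) * ‖1 - conj z * a‖ := by
    have e : 1 - conj w * a = (1 - conj z * a) + conj (z - w) * a := by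
      rw [map_sub]; ring
    have : ‖1 - conj w * a‖ ≤ ‖1 - conj z * a‖ + ‖z - w‖ := by
      rw [e]
      refine (norm_add_le _ _).trans ?_
      rw [norm_mul, RCLike.norm_conj]
      nlinarith [norm_nonneg (z - w)]
    have h5 : ‖z - w‖ ≤ t * ((2 * ‖1 - conj z * a‖) / (1 - t)) :=
      h1.trans (by gcongr; exact h2.trans (by gcongr))
    calc _ ≤ ‖1 - conj z * a‖ + t * ((2 * ‖1 - conj z * a‖) / (1 - t)) :=
          this.trans (by gcongr)
      _ = _ := by ring
  have h6 : 1 - ‖z‖ ^ 2 ≤ 4 / (1 - t ^ 2) * (1 - ‖w‖ ^ 2) := by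
    have e := one_sub_rho_sq hz hw
    have e2 : 1 - t ^ 2 ≤ 1 - rho z w ^ 2 := by nlinarith [rho_nonneg z w]
    rw [e, le_div_iff₀ (by positivity)] at e2
    have h7 : (1 - ‖z‖ ^ 2) ≤ 2 * ‖1 - conj z * w‖ := by
      have := one_sub_norm_le_norm_one_sub_conj_mul (a := w) (z := z) hw.le
      rw [norm_one_sub_conj_mul_comm] at this
      nlinarith [norm_nonneg z]
    have h8 : (1 - t ^ 2) * (1 - ‖z‖ ^ 2) ^ 2 ≤ 4 * ((1 - ‖z‖ ^ 2) * (1 - ‖w‖ ^ 2)) := by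
      calc _ ≤ (1 - t ^ 2) * (2 * ‖1 - conj z * w‖) ^ 2 := by gcongr
        _ ≤ _ := by linarith
    rw [div_mul_eq_mul_div, le_div_iff₀ ht2]
    nlinarith
  rw [one_sub_rho_sq hz ha, one_sub_rho_sq hw ha, mul_div_assoc', div_le_div_iff₀ (by positivity)
    (by positivity)]
  calc (1 - ‖z‖ ^ 2) * (1 - ‖a‖ ^ 2) * ‖1 - conj w * a‖ ^ 2
      ≤ (4 / (1 - t ^ 2) * (1 - ‖w‖ ^ 2)) * (1 - ‖a‖ ^ 2) *
          ((1 + 2 * t / (1 - t)) * ‖1 - conj z * a‖) ^ 2 := by gcongr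
    _ = _ := by ring

/-! ### Infinite Blaschke products -/

section BlaschkeProduct

variable {ι : Type*} {a : ι → ℂ}

theorem summable_norm_blaschkeFactor_sub_one (ha : ∀ i, ‖a i‖ < 1)
    (hs : Summable fun i => 1 - ‖a i‖) {z : ℂ} (hz : ‖z‖ < 1) :
    Summable fun i => ‖blaschkeFactor (a i) z - 1‖ :=
  (hs.mul_right _).of_nonneg_of_le (fun _ => norm_nonneg _)
    fun i => norm_blaschkeFactor_sub_one_le (ha i) hz

theorem multipliable_blaschkeFactor (ha : ∀ i, ‖a i‖ < 1)
    (hs : Summable fun i => 1 - ‖a i‖) {z : ℂ} (hz : ‖z‖ < 1) :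
    Multipliable fun i => blaschkeFactor (a i) z := by
  simpa using multipliable_one_add_of_summable (summable_norm_blaschkeFactor_sub_one ha hs hz)

theorem tprod_blaschkeFactor_ne_zero (ha : ∀ i, ‖a i‖ < 1)
    (hs : Summable fun i => 1 - ‖a i‖) {z : ℂ} (hz : ‖z‖ < 1) (hne : ∀ i, a i ≠ z) :
    ∏' i, blaschkeFactor (a i) z ≠ 0 := by
  have := tprod_one_add_ne_zero_of_summable (f := fun i => blaschkeFactor (a i) z - 1)
    (fun i => by
      rw [add_sub_cancel, ne_eq, blaschkeFactor_eq_zero_iff (ha i) hz]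
      exact hne i)
    (summable_norm_blaschkeFactor_sub_one ha hs hz)
  simpa using this

theorem le_norm_tprod_blaschkeFactor (ha : ∀ i, ‖a i‖ < 1)
    (hs : Summable fun i => 1 - ‖a i‖) {z : ℂ} (hz : ‖z‖ < 1) {c : ℝ}
    (hc : ∀ F : Finset ι, c ≤ ∏ i ∈ F, rho (a i) z) : c ≤ ‖∏' i, blaschkeFactor (a i) z‖ := by
  refine ge_of_tendsto (multipliable_blaschkeFactor ha hs hz).hasProd.norm
    (Eventually.of_forall fun F => ?_)
  simpa [norm_prod, norm_blaschkeFactor] using hc F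

theorem norm_tprod_blaschkeFactor_le_one (ha : ∀ i, ‖a i‖ < 1)
    (hs : Summable fun i => 1 - ‖a i‖) {z : ℂ} (hz : ‖z‖ < 1) :
    ‖∏' i, blaschkeFactor (a i) z‖ ≤ 1 := by
  refine le_of_tendsto (multipliable_blaschkeFactor ha hs hz).hasProd.norm
    (Eventually.of_forall fun F => ?_)
  exact Finset.prod_le_one (fun _ _ => norm_nonneg _)
    fun i _ => norm_blaschkeFactor_le_one (ha i) hz

/-- The majorants for products and series below contain powers of `1 / (1 - r)`, so they are uniform
only on smaller discs. -/
theorem differentiableOn_ball_of_forall_lt {E : Type*} [NormedAddCommGroup E] [NormedSpace ℂ E]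
    {f : ℂ → E} (h : ∀ r < 1, DifferentiableOn ℂ f (ball 0 r)) :
    DifferentiableOn ℂ f (ball 0 1) := by
  intro z hz
  obtain ⟨r, hr, hr1⟩ := exists_between (mem_ball_zero_iff.mp hz)
  exact ((h r hr1).differentiableAt (isOpen_ball.mem_nhds
    (mem_ball_zero_iff.mpr hr))).differentiableWithinAt

theorem differentiableOn_tprod_blaschkeFactor (ha : ∀ i, ‖a i‖ < 1)
    (hs : Summable fun i => 1 - ‖a i‖) :
    DifferentiableOn ℂ (fun z => ∏' i, blaschkeFactor (a i) z) (ball 0 1) := by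
  refine differentiableOn_ball_of_forall_lt fun r hr => ?_
  have hd : ∀ i, DifferentiableOn ℂ (blaschkeFactor (a i)) (ball 0 r) := fun i =>
    (differentiableOn_blaschkeFactor (ha i)).mono (ball_subset_ball hr.le)
  have h := Summable.hasProdLocallyUniformlyOn_one_add (K := ball (0 : ℂ) r)
    (f := fun i z => blaschkeFactor (a i) z - 1) isOpen_ball (hs.mul_right (2 / (1 - r)))
    (Eventually.of_forall fun i z hz => ?_) (fun i => (hd i).continuousOn.sub continuousOn_const)
  · simp only [add_sub_cancel] at h
    rw [hasProdLocallyUniformlyOn_iff_tendstoLocallyUniformlyOn] at h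
    refine h.differentiableOn (Eventually.of_forall fun F => ?_) isOpen_ball
    exact DifferentiableOn.fun_finsetProd fun i _ => hd i
  · have hz' := mem_ball_zero_iff.mp hz
    have : 0 < 1 - r := by linarith
    have : 0 ≤ 1 - ‖a i‖ := by linarith [ha i]
    refine (norm_blaschkeFactor_sub_one_le (ha i) (hz'.trans hr)).trans ?_
    gcongr

theorem prod_mul_tprod_blaschkeFactor (ha : ∀ i, ‖a i‖ < 1)
    (hs : Summable fun i => 1 - ‖a i‖) {z : ℂ} (hz : ‖z‖ < 1) (F : Finset ι) :
    (∏ i ∈ F, blaschkeFactor (a i) z) * ∏' i : {i // i ∉ F}, blaschkeFactor (a i) z =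
      ∏' i, blaschkeFactor (a i) z := by
  have h1 := F.hasProd (fun i => blaschkeFactor (a i) z)
  have h2 := (multipliable_blaschkeFactor (a := fun i : {i // i ∉ F} => a i) (fun i => ha i)
    (hs.subtype _) hz).hasProd
  exact (HasProd.mul_compl (s := (F : Set ι)) h1 h2).tprod_eq.symm

end BlaschkeProduct

/-! ### Jones' interpolation formula -/

/-- With `s = 1 - r ^ 2`, the squared claim follows from `exp (4 * s) ≥ 1 + 4 * s` and `(1 - s) * (1
+ 4 * s) ≥ 1`, valid for `0 ≤ s ≤ 3 / 4`. It turns the Carleson sum of a separated family into a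
lower bound for products. -/
theorem exp_neg_le_of_half_le {r : ℝ} (h0 : 1 / 2 ≤ r) (h1 : r ≤ 1) :
    Real.exp (-(2 * (1 - r ^ 2))) ≤ r := by
  have hr : 0 ≤ 1 - r ^ 2 := by nlinarith
  rw [← sq_le_sq₀ (Real.exp_pos _).le (by linarith), ← Real.exp_nat_mul]
  have h2 := Real.add_one_le_exp (4 * (1 - r ^ 2))
  have h3 : Real.exp (((2 : ℕ) : ℝ) * -(2 * (1 - r ^ 2))) = (Real.exp (4 * (1 - r ^ 2)))⁻¹ := by
    rw [← Real.exp_neg]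
    congr 1
    push_cast
    ring
  rw [h3]
  refine inv_le_of_inv_le₀ (by positivity) (le_trans ?_ h2)
  rw [inv_le_iff_one_le_mul₀ (by positivity)]
  nlinarith [mul_nonneg hr (show 0 ≤ 4 * r ^ 2 - 1 by nlinarith)]

/-- A discrete form of `∫ exp (-u) du ≤ 1`: with the indices ordered by `y`, the terms are dominated
by a telescoping sum, since `x * exp (-x) ≤ 1 - exp (-x)`. Ties in `y` only enlarge the exponents.
The induction adds the smallest `y` last, so that its exponent is the full sum. -/
theorem sum_mul_exp_neg_le_one {ι : Type*} (x y : ι → ℝ) (hx : ∀ i, 0 ≤ x i)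
    (J : Finset ι) :
    ∑ j ∈ J, x j * Real.exp (-∑ k ∈ J with y j ≤ y k, x k) ≤ 1 - Real.exp (-∑ k ∈ J, x k) := by
  classical
  induction J using Finset.induction_on_min_value y with
  | empty => simp
  | insert j J hj hmin ih =>
    have e : (insert j J).filter (fun k => y j ≤ y k) = insert j J :=
      Finset.filter_true_of_mem fun k hk => by
        rcases Finset.mem_insert.mp hk with rfl | hk
        exacts [le_rfl, hmin k hk]
    rw [Finset.sum_insert hj, e]
    have h1 : ∑ i ∈ J, x i * Real.exp (-∑ k ∈ insert j J with y i ≤ y k, x k) ≤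
        ∑ i ∈ J, x i * Real.exp (-∑ k ∈ J with y i ≤ y k, x k) := by
      refine Finset.sum_le_sum fun i _ => mul_le_mul_of_nonneg_left ?_ (hx i)
      refine Real.exp_le_exp.mpr (neg_le_neg ?_)
      exact Finset.sum_le_sum_of_subset_of_nonneg
        (Finset.filter_subset_filter _ (Finset.subset_insert _ _)) fun k _ _ => hx k
    rw [Finset.sum_insert hj, neg_add, Real.exp_add]
    have h2 : x j * Real.exp (-x j) ≤ 1 - Real.exp (-x j) := by
      have := Real.add_one_le_exp (x j)
      have h3 : Real.exp (x j) * Real.exp (-x j) = 1 := by rw [← Real.exp_add]; simp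
      nlinarith [Real.exp_pos (-x j)]
    nlinarith [Real.exp_pos (-∑ k ∈ J, x k)]

section Interpolation

variable {ι : Type*} (a : ι → ℂ)

open Classical in
/-- The terms of the sum in the exponent of Jones' interpolation formula. -/
noncomputable def jonesTerm (j k : ι) (z : ℂ) : ℂ :=
  if ‖a j‖ ≤ ‖a k‖ then
    ((1 - ‖a k‖ ^ 2 : ℝ) : ℂ) * ((1 + conj (a k) * z) / (1 - conj (a k) * z)) else 0

/-- The exponent in Jones' interpolation formula. -/
noncomputable def jonesExponent (j : ι) (z : ℂ) : ℂ := ∑' k, jonesTerm a j k z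

/-- The squared modulus of the rational factor in Jones' interpolation formula. -/
noncomputable def jonesWeight (k : ι) (z : ℂ) : ℝ := (1 - ‖a k‖ ^ 2) ^ 2 / ‖1 - conj (a k) * z‖ ^ 2

variable {a}

theorem norm_jonesTerm_le (ha : ∀ i, ‖a i‖ < 1) (j k : ι) {z : ℂ} {r : ℝ} (hr : r < 1)
    (hz : ‖z‖ < r) : ‖jonesTerm a j k z‖ ≤ (1 - ‖a k‖) * (4 / (1 - r)) := by
  have hr' : 0 < 1 - r := by linarith
  have hk : 0 < 1 - ‖a k‖ := by linarith [ha k]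
  unfold jonesTerm
  split_ifs
  · have h1 := one_sub_norm_le_norm_one_sub_conj_mul (z := z) (ha k).le
    have h2 : ‖1 + conj (a k) * z‖ ≤ 2 := by
      refine (norm_add_le _ _).trans ?_
      rw [norm_mul, RCLike.norm_conj, norm_one]
      nlinarith [norm_nonneg z, norm_nonneg (a k), ha k]
    rw [norm_mul, Complex.norm_real, Real.norm_of_nonneg (one_sub_norm_sq_pos (ha k)).le, norm_div]
    have h3 : 1 - ‖a k‖ ^ 2 ≤ (1 - ‖a k‖) * 2 := by nlinarith [norm_nonneg (a k)]
    calc _ ≤ ((1 - ‖a k‖) * 2) * (2 / (1 - r)) := by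
          gcongr
          linarith
      _ = _ := by ring
  · rw [norm_zero]
    positivity

theorem differentiableOn_one_sub_conj_mul_inv {b : ℂ} (hb : ‖b‖ < 1) :
    DifferentiableOn ℂ (fun z => (1 - conj b * z)⁻¹) (ball 0 1) := by
  intro z hz
  have := one_sub_conj_mul_ne_zero hb (mem_ball_zero_iff.mp hz).le
  apply DifferentiableAt.differentiableWithinAt
  fun_prop (disch := assumption)

theorem differentiableOn_jonesTerm (ha : ∀ i, ‖a i‖ < 1) (j k : ι) :
    DifferentiableOn ℂ (jonesTerm a j k) (ball 0 1) := by
  unfold jonesTerm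
  split_ifs
  · simp only [div_eq_mul_inv]
    have := differentiableOn_one_sub_conj_mul_inv (ha k)
    fun_prop
  · exact differentiableOn_const _

theorem summable_jonesTerm (ha : ∀ i, ‖a i‖ < 1) (hs : Summable fun i => 1 - ‖a i‖) (j : ι)
    {z : ℂ} (hz : ‖z‖ < 1) : Summable fun k => jonesTerm a j k z := by
  obtain ⟨r, hr, hr1⟩ := exists_between hz
  exact (hs.mul_right _).of_norm_bounded fun k => norm_jonesTerm_le ha j k hr1 hr

theorem differentiableOn_jonesExponent (ha : ∀ i, ‖a i‖ < 1)
    (hs : Summable fun i => 1 - ‖a i‖) (j : ι) :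
    DifferentiableOn ℂ (jonesExponent a j) (ball 0 1) := by
  refine differentiableOn_ball_of_forall_lt fun r hr => ?_
  exact Complex.differentiableOn_tsum_of_summable_norm (hs.mul_right (4 / (1 - r)))
    (fun k => (differentiableOn_jonesTerm ha j k).mono (ball_subset_ball hr.le)) isOpen_ball
    fun k z hz => norm_jonesTerm_le ha j k hr (mem_ball_zero_iff.mp hz)

theorem re_one_add_div_one_sub {w : ℂ} (hw : 1 - w ≠ 0) :
    ((1 + w) / (1 - w)).re = (1 - ‖w‖ ^ 2) / ‖1 - w‖ ^ 2 := by
  have h : Complex.normSq (1 - w) ≠ 0 := by simpa using hw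
  rw [Complex.div_re, ← Complex.normSq_eq_norm_sq, ← Complex.normSq_eq_norm_sq, ← add_div]
  congr 1
  simp [Complex.normSq_apply]
  ring

theorem re_jonesTerm_of_le (ha : ∀ i, ‖a i‖ < 1) {j k : ι} {z : ℂ} (hz : ‖z‖ < 1)
    (h : ‖a j‖ ≤ ‖a k‖) : (jonesTerm a j k z).re =
      (1 - ‖a k‖ ^ 2) * ((1 - ‖a k‖ ^ 2 * ‖z‖ ^ 2) / ‖1 - conj (a k) * z‖ ^ 2) := by
  rw [jonesTerm, if_pos h, Complex.re_ofReal_mul,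
    re_one_add_div_one_sub (one_sub_conj_mul_ne_zero (ha k) hz.le), norm_mul, RCLike.norm_conj,
    mul_pow]

theorem jonesWeight_nonneg (k : ι) (z : ℂ) : 0 ≤ jonesWeight a k z := by
  unfold jonesWeight; positivity

theorem jonesWeight_le_re_jonesTerm (ha : ∀ i, ‖a i‖ < 1) {j k : ι} {z : ℂ} (hz : ‖z‖ < 1)
    (h : ‖a j‖ ≤ ‖a k‖) : jonesWeight a k z ≤ (jonesTerm a j k z).re := by
  have h1 := one_sub_norm_sq_pos (ha k)
  have h2 : ‖z‖ ^ 2 ≤ 1 := by nlinarith [norm_nonneg z]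
  rw [re_jonesTerm_of_le ha hz h, jonesWeight, sq (1 - ‖a k‖ ^ 2), mul_div_assoc]
  gcongr
  nlinarith [sq_nonneg ‖a k‖]

theorem re_jonesTerm_nonneg (ha : ∀ i, ‖a i‖ < 1) (j k : ι) {z : ℂ} (hz : ‖z‖ < 1) :
    0 ≤ (jonesTerm a j k z).re := by
  by_cases h : ‖a j‖ ≤ ‖a k‖
  · exact (jonesWeight_nonneg k z).trans (jonesWeight_le_re_jonesTerm ha hz h)
  · simp [jonesTerm, h]

theorem hasSum_re_jonesTerm (ha : ∀ i, ‖a i‖ < 1) (hs : Summable fun i => 1 - ‖a i‖) (j : ι)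
    {z : ℂ} (hz : ‖z‖ < 1) :
    HasSum (fun k => (jonesTerm a j k z).re) (jonesExponent a j z).re :=
  Complex.hasSum_re (summable_jonesTerm ha hs j hz).hasSum

theorem sum_jonesWeight_le_re_jonesExponent (ha : ∀ i, ‖a i‖ < 1)
    (hs : Summable fun i => 1 - ‖a i‖) (j : ι) {z : ℂ} (hz : ‖z‖ < 1) (J : Finset ι) :
    ∑ k ∈ J with ‖a j‖ ≤ ‖a k‖, jonesWeight a k z ≤ (jonesExponent a j z).re :=
  (Finset.sum_le_sum fun _ hk =>
    jonesWeight_le_re_jonesTerm ha hz (Finset.mem_filter.mp hk).2).trans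
      (sum_le_hasSum _ (fun k _ => re_jonesTerm_nonneg ha j k hz) (hasSum_re_jonesTerm ha hs j hz))

/-- Here the restriction `‖a j‖ ≤ ‖a k‖` pays off: it gives `1 - ‖a k‖ ^ 2 * ‖a j‖ ^ 2 ≤ 2 * (1 - ‖a
j‖ ^ 2)`, so each term is at most `2 * (1 - rho ^ 2)`. -/
theorem re_jonesExponent_self_le (ha : ∀ i, ‖a i‖ < 1)
    (hs : Summable fun i => 1 - ‖a i‖) {j : ι} {M : ℝ}
    (hM : ∀ F : Finset ι, ∑ k ∈ F, (1 - rho (a j) (a k) ^ 2) ≤ M) :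
    (jonesExponent a j (a j)).re ≤ 2 * M := by
  refine le_of_tendsto (hasSum_re_jonesTerm ha hs j (ha j)) (Eventually.of_forall fun F => ?_)
  refine le_trans ?_ (mul_le_mul_of_nonneg_left (hM F) zero_le_two)
  rw [Finset.mul_sum]
  refine Finset.sum_le_sum fun k _ => ?_
  by_cases h : ‖a j‖ ≤ ‖a k‖
  · have h1 := one_sub_norm_sq_pos (ha k)
    have h2 := one_sub_norm_sq_pos (ha j)
    rw [re_jonesTerm_of_le ha (ha j) h, rho_comm, one_sub_rho_sq (ha k) (ha j)]
    have h3 : ‖a j‖ ^ 2 ≤ ‖a k‖ ^ 2 := by gcongr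
    have h4 : 1 - ‖a k‖ ^ 2 * ‖a j‖ ^ 2 ≤ 2 * (1 - ‖a j‖ ^ 2) := by
      nlinarith [sq_nonneg ‖a j‖, sq_nonneg (1 - ‖a j‖ ^ 2)]
    calc _ ≤ (1 - ‖a k‖ ^ 2) * ((2 * (1 - ‖a j‖ ^ 2)) / ‖1 - conj (a k) * a j‖ ^ 2) := by gcongr
      _ = _ := by ring
  · rw [jonesTerm, if_neg h]
    have := one_sub_rho_sq_pos (ha j) (ha k)
    simp only [Complex.zero_re]
    positivity

/-- **Carleson's interpolation theorem** for separated families, by Jones' explicit formula. -/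
theorem exists_isHInfty_interpolating (ha : ∀ i, ‖a i‖ < 1) (hs : Summable fun i => 1 - ‖a i‖)
    {M : ℝ} (hM : ∀ j, ∀ F : Finset ι, ∑ k ∈ F, (1 - rho (a j) (a k) ^ 2) ≤ M)
    (hsep : ∀ i j, i ≠ j → 1 / 2 ≤ rho (a i) (a j)) (v : ι → ℂ) {C : ℝ}
    (hv : ∀ i, ‖v i‖ ≤ C) : ∃ f, IsHInfty f ∧ ∀ i, f (a i) = v i := by
  classical
  let B : ι → ℂ → ℂ := fun j z => ∏' k : {k // k ≠ j}, blaschkeFactor (a k) z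
  have haj : ∀ j : ι, ∀ k : {k // k ≠ j}, ‖a k‖ < 1 := fun j k => ha k
  have hsj : ∀ j : ι, Summable fun k : {k // k ≠ j} => 1 - ‖a k‖ := fun j => hs.subtype _
  have hBd : ∀ j, DifferentiableOn ℂ (B j) (ball 0 1) := fun j =>
    differentiableOn_tprod_blaschkeFactor (haj j) (hsj j)
  have hB1 : ∀ j z, ‖z‖ < 1 → ‖B j z‖ ≤ 1 := fun j z hz =>
    norm_tprod_blaschkeFactor_le_one (haj j) (hsj j) hz
  have hB0 : ∀ i j, i ≠ j → B j (a i) = 0 := fun i j hij =>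
    by
    have : ∃ k : {k // k ≠ j}, blaschkeFactor (a k) (a i) = 0 :=
      ⟨⟨i, hij⟩, (blaschkeFactor_eq_zero_iff (ha i) (ha i)).mpr rfl⟩
    exact tprod_of_exists_eq_zero this
  have hBj : ∀ j, Real.exp (-(2 * M)) ≤ ‖B j (a j)‖ := fun j => by
    refine le_norm_tprod_blaschkeFactor (haj j) (hsj j) (ha j) fun F => ?_
    calc Real.exp (-(2 * M))
        ≤ Real.exp (∑ k ∈ F, -(2 * (1 - rho (a k) (a j) ^ 2))) := by
          rw [Finset.sum_neg_distrib, ← Finset.mul_sum]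
          gcongr
          have := hM j (F.map (Function.Embedding.subtype _))
          simpa [Finset.sum_map, rho_comm] using this
      _ = ∏ k ∈ F, Real.exp (-(2 * (1 - rho (a k) (a j) ^ 2))) := Real.exp_sum _ _
      _ ≤ _ := Finset.prod_le_prod (fun _ _ => (Real.exp_pos _).le) fun k _ =>
          exp_neg_le_of_half_le (hsep k j k.2) (rho_lt_one (ha k) (ha j)).le
  have hBj0 : ∀ j, B j (a j) ≠ 0 := fun j =>
    norm_pos_iff.mp ((Real.exp_pos _).trans_le (hBj j))
  -- At `a j` every factor except `v j` equals `1`; at the other nodes `B j` vanishes. The squared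
  -- kernel has modulus `jonesWeight`, and the exponential damps it enough to make the sum over `j`
  -- bounded.
  let T : ι → ℂ → ℂ := fun j z => v j * (B j z / B j (a j)) *
    (((1 - ‖a j‖ ^ 2 : ℝ) : ℂ) * (1 - conj (a j) * z)⁻¹) ^ 2 *
    Complex.exp (jonesExponent a j (a j) - jonesExponent a j z)
  let D : ℝ := C * Real.exp (2 * M) * Real.exp (2 * M)
  have hTd : ∀ j, DifferentiableOn ℂ (T j) (ball 0 1) := fun j => by
    have h1 := hBd j
    have h2 := differentiableOn_one_sub_conj_mul_inv (ha j)
    have h3 := differentiableOn_jonesExponent ha hs j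
    simp only [T, div_eq_mul_inv]
    fun_prop
  have hTle : ∀ j z, ‖z‖ < 1 →
      ‖T j z‖ ≤ D * (jonesWeight a j z * Real.exp (-(jonesExponent a j z).re)) := fun j z hz => by
    have h1 : ‖B j z / B j (a j)‖ ≤ Real.exp (2 * M) := by
      rw [norm_div, div_le_iff₀ (norm_pos_iff.mpr (hBj0 j))]
      calc ‖B j z‖ ≤ 1 := hB1 j z hz
        _ = Real.exp (2 * M) * Real.exp (-(2 * M)) := by rw [← Real.exp_add]; simp
        _ ≤ _ := by gcongr; exact hBj j
    have h2 : ‖(((1 - ‖a j‖ ^ 2 : ℝ) : ℂ) * (1 - conj (a j) * z)⁻¹) ^ 2‖ = jonesWeight a j z := by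
      rw [norm_pow, norm_mul, norm_inv, Complex.norm_real,
        Real.norm_of_nonneg (one_sub_norm_sq_pos (ha j)).le, jonesWeight, mul_pow, inv_pow]
      rfl
    have h3 : ‖Complex.exp (jonesExponent a j (a j) - jonesExponent a j z)‖ ≤
        Real.exp (2 * M) * Real.exp (-(jonesExponent a j z).re) := by
      rw [Complex.norm_exp, ← Real.exp_add]
      gcongr
      rw [Complex.sub_re]
      linarith [re_jonesExponent_self_le ha hs (hM j)]
    have hC : 0 ≤ C := (norm_nonneg _).trans (hv j)
    have hw := jonesWeight_nonneg (a := a) j z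
    simp only [T]
    rw [norm_mul, norm_mul, norm_mul, h2]
    calc _ ≤ C * Real.exp (2 * M) * jonesWeight a j z *
          (Real.exp (2 * M) * Real.exp (-(jonesExponent a j z).re)) := by
          gcongr
          exact hv j
      _ = _ := by simp only [D]; ring
  -- Without an index, `hv` does not force `C ≥ 0`.
  rcases isEmpty_or_nonempty ι with he | ⟨⟨i0⟩⟩
  · exact ⟨0, ⟨differentiableOn_const _, 0, by simp⟩, fun i => he.elim i⟩
  have hC : 0 ≤ C := (norm_nonneg _).trans (hv i0)
  have hD : 0 ≤ D := by positivity
  have hsum : ∀ z, ‖z‖ < 1 → ∀ J : Finset ι, ∑ j ∈ J, ‖T j z‖ ≤ D := fun z hz J => by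
    calc ∑ j ∈ J, ‖T j z‖
        ≤ ∑ j ∈ J, D * (jonesWeight a j z *
            Real.exp (-∑ k ∈ J with ‖a j‖ ≤ ‖a k‖, jonesWeight a k z)) := by
          refine Finset.sum_le_sum fun j _ => (hTle j z hz).trans ?_
          have hw := jonesWeight_nonneg (a := a) j z
          gcongr
          exact sum_jonesWeight_le_re_jonesExponent ha hs j hz J
      _ ≤ D * 1 := by
          rw [← Finset.mul_sum]
          gcongr
          refine (sum_mul_exp_neg_le_one _ (fun i => ‖a i‖)
            (fun k => jonesWeight_nonneg (a := a) k z) J).trans ?_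
          linarith [Real.exp_pos (-∑ k ∈ J, jonesWeight a k z)]
      _ = D := mul_one D
  refine ⟨fun z => ∑' j, T j z, ⟨?_, D, fun z hz => ?_⟩, fun i => ?_⟩
  -- Analyticity needs a summable majorant on smaller discs, which `hs` supplies; the global bound
  -- `D` comes from `hsum`.
  · refine differentiableOn_ball_of_forall_lt fun r hr => ?_
    refine Complex.differentiableOn_tsum_of_summable_norm (hs.mul_right (D * (2 / (1 - r) ^ 2)))
      (fun j => (hTd j).mono (ball_subset_ball hr.le)) isOpen_ball fun j z hz => ?_
    have hz' := mem_ball_zero_iff.mp hz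
    have hr' : 0 < 1 - r := by linarith
    have haj' := norm_nonneg (a j)
    have h1 := one_sub_norm_sq_pos (ha j)
    have h2 := one_sub_norm_le_norm_one_sub_conj_mul (z := z) (ha j).le
    refine (hTle j z (hz'.trans hr)).trans ?_
    have h3 : jonesWeight a j z ≤ (1 - ‖a j‖) * 2 / (1 - r) ^ 2 := by
      unfold jonesWeight
      have : (1 - ‖a j‖ ^ 2) ^ 2 ≤ (1 - ‖a j‖) * 2 := by
        have : (1 - ‖a j‖ ^ 2) ^ 2 ≤ 1 - ‖a j‖ ^ 2 := by nlinarith [sq_nonneg ‖a j‖]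
        nlinarith [ha j]
      have : 0 ≤ 1 - ‖a j‖ := by linarith [ha j]
      gcongr
      linarith
    have h4 : Real.exp (-(jonesExponent a j z).re) ≤ 1 := by
      rw [Real.exp_le_one_iff, neg_nonpos]
      simpa using sum_jonesWeight_le_re_jonesExponent ha hs j (hz'.trans hr) ∅
    calc _ ≤ D * ((1 - ‖a j‖) * 2 / (1 - r) ^ 2 * 1) := by
          have := jonesWeight_nonneg (a := a) j z
          have : 0 ≤ (1 - ‖a j‖) * 2 / (1 - r) ^ 2 := this.trans h3
          gcongr
      _ = _ := by ring
  · have hz' := mem_ball_zero_iff.mp hz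
    have hS : Summable fun j => ‖T j z‖ :=
      summable_of_sum_le (fun _ => norm_nonneg _) (hsum z hz')
    exact (norm_tsum_le_tsum_norm hS).trans (hS.tsum_le_of_sum_le (hsum z hz'))
  · have h0 : ∀ j, j ≠ i → T j (a i) = 0 := fun j hj => by
      simp [T, hB0 i j hj.symm]
    have h1 : ((1 - ‖a i‖ ^ 2 : ℝ) : ℂ) * (1 - conj (a i) * a i)⁻¹ = 1 := by
      rw [Complex.conj_mul']
      push_cast
      refine mul_inv_cancel₀ ?_
      rw [← Complex.conj_mul']
      exact one_sub_conj_mul_ne_zero (ha i) (ha i).le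
    simp only
    rw [tsum_eq_single i h0]
    simp only [T]
    rw [h1, div_self (hBj0 i)]
    simp

end Interpolation

/-! ### Zeros with multiplicity and the Blaschke factorization -/

theorem analyticAt_of_differentiableOn_ball {f : ℂ → ℂ} (hf : DifferentiableOn ℂ f (ball 0 1))
    {z : ℂ} (hz : ‖z‖ < 1) : AnalyticAt ℂ f z :=
  hf.analyticAt (isOpen_ball.mem_nhds (mem_ball_zero_iff.mpr hz))

theorem exists_blaschkeFactor_eq_sub_mul {a : ℂ} (ha : ‖a‖ < 1) :
    ∃ u : ℂ → ℂ, DifferentiableOn ℂ u (ball 0 1) ∧ (∀ z, ‖z‖ < 1 → u z ≠ 0) ∧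
      ∀ z, blaschkeFactor a z = (z - a) * u z := by
  by_cases h : a = 0
  · exact ⟨fun _ => 1, differentiableOn_const _, fun _ _ => one_ne_zero, fun z => by
      simp [blaschkeFactor, h]⟩
  · refine ⟨fun z => -(‖a‖ / a) * (1 - conj a * z)⁻¹,
      (differentiableOn_one_sub_conj_mul_inv ha).const_mul _, fun z hz => ?_, fun z => ?_⟩
    · have := one_sub_conj_mul_ne_zero ha hz.le
      have h' : (‖a‖ : ℂ) ≠ 0 := by simpa using h
      exact mul_ne_zero (neg_ne_zero.mpr (div_ne_zero h' h)) (inv_ne_zero this)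
    · rw [blaschkeFactor, if_neg h, phi, div_eq_mul_inv (a - z), mul_comm z]
      ring

theorem analyticOrderAt_blaschkeFactor {a z : ℂ} (ha : ‖a‖ < 1) (hz : ‖z‖ < 1) :
    analyticOrderAt (blaschkeFactor a) z = if a = z then 1 else 0 := by
  obtain ⟨u, hu, hu0, h⟩ := exists_blaschkeFactor_eq_sub_mul ha
  split_ifs with hza
  · subst hza
    have hua := analyticAt_of_differentiableOn_ball hu hz
    have e : blaschkeFactor a = (fun z => z - a) * u := funext h
    rw [e, analyticOrderAt_mul (by fun_prop) hua, hua.analyticOrderAt_eq_zero.mpr (hu0 a hz),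
      add_zero]
    exact analyticOrderAt_id_sub_const_self
  · rw [(analyticAt_of_differentiableOn_ball
      (differentiableOn_blaschkeFactor ha) hz).analyticOrderAt_eq_zero]
    exact mt (blaschkeFactor_eq_zero_iff ha hz).mp hza

theorem norm_le_of_eventually_nhdsNE {g : ℂ → ℂ} {z : ℂ} {c : ℝ} (hg : ContinuousAt g z)
    (h : ∀ᶠ w in 𝓝[≠] z, ‖g w‖ ≤ c) : ‖g z‖ ≤ c :=
  le_of_tendsto (hg.norm.tendsto.mono_left nhdsWithin_le_nhds) h

/-- By Schwarz-Pick, dividing out a zero does not raise the bound `1` away from `a`; continuity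
covers `a` itself. -/
theorem exists_eq_blaschkeFactor_mul {g : ℂ → ℂ} (hg : DifferentiableOn ℂ g (ball 0 1))
    (hg1 : ∀ z, ‖z‖ < 1 → ‖g z‖ ≤ 1) {a : ℂ} (ha : ‖a‖ < 1) (hga : g a = 0) :
    ∃ h : ℂ → ℂ, DifferentiableOn ℂ h (ball 0 1) ∧ (∀ z, ‖z‖ < 1 → ‖h z‖ ≤ 1) ∧
      ∀ z, ‖z‖ < 1 → g z = blaschkeFactor a z * h z := by
  obtain ⟨u, hu, hu0, hbu⟩ := exists_blaschkeFactor_eq_sub_mul ha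
  have hd : DifferentiableOn ℂ (fun z => dslope g a z / u z) (ball 0 1) :=
    ((Complex.differentiableOn_dslope (isOpen_ball.mem_nhds (mem_ball_zero_iff.mpr ha))).mpr
      hg).div hu fun z hz => hu0 z (mem_ball_zero_iff.mp hz)
  have heq : ∀ z, ‖z‖ < 1 → g z = blaschkeFactor a z * (dslope g a z / u z) := fun z hz => by
    have h := sub_smul_dslope g a z
    rw [hga, sub_zero, smul_eq_mul] at h
    have := hu0 z hz
    rw [hbu, ← h]
    field_simp
  have hne : ∀ z, ‖z‖ < 1 → z ≠ a → ‖dslope g a z / u z‖ ≤ 1 := fun z hz hza => by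
    have h0 : 0 < ‖blaschkeFactor a z‖ :=
      norm_pos_iff.mpr (mt (blaschkeFactor_eq_zero_iff ha hz).mp (Ne.symm hza))
    have h1 := norm_le_rho_of_eq_zero hg (fun z hz => hg1 z (mem_ball_zero_iff.mp hz)) ha hz hga
    rw [heq z hz, norm_mul, ← norm_blaschkeFactor] at h1
    exact le_of_mul_le_mul_left (by rwa [mul_one]) h0
  refine ⟨_, hd, fun z hz => ?_, heq⟩
  by_cases hza : z = a
  · subst hza
    refine norm_le_of_eventually_nhdsNE (g := fun z => dslope g _ z / u z)
      (analyticAt_of_differentiableOn_ball hd hz).continuousAt ?_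
    have hb : ∀ᶠ w in 𝓝[≠] z, w ∈ ball (0 : ℂ) 1 :=
      nhdsWithin_le_nhds (isOpen_ball.mem_nhds (mem_ball_zero_iff.mpr hz))
    filter_upwards [hb, self_mem_nhdsWithin] with w hw hwz using hne w (mem_ball_zero_iff.mp hw) hwz
  · exact hne z hz hza

section Factorization

variable {ι : Type*} {a : ι → ℂ}

theorem differentiableOn_prod_blaschkeFactor (ha : ∀ i, ‖a i‖ < 1) (F : Finset ι) :
    DifferentiableOn ℂ (fun z => ∏ i ∈ F, blaschkeFactor (a i) z) (ball 0 1) :=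
  DifferentiableOn.fun_finsetProd fun i _ => differentiableOn_blaschkeFactor (ha i)

open Classical in
theorem analyticOrderAt_prod_blaschkeFactor (ha : ∀ i, ‖a i‖ < 1) (F : Finset ι) {z : ℂ}
    (hz : ‖z‖ < 1) :
    analyticOrderAt (fun z => ∏ i ∈ F, blaschkeFactor (a i) z) z =
      ({i ∈ F | a i = z}.card : ℕ∞) := by
  induction F using Finset.induction_on with
  | empty => simp [analyticAt_const.analyticOrderAt_eq_zero]
  | insert j F hj ih =>
    have e : (fun z => ∏ i ∈ insert j F, blaschkeFactor (a i) z) =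
        blaschkeFactor (a j) * fun z => ∏ i ∈ F, blaschkeFactor (a i) z :=
      funext fun z => Finset.prod_insert hj
    rw [e, analyticOrderAt_mul
      (analyticAt_of_differentiableOn_ball (differentiableOn_blaschkeFactor (ha j)) hz)
      (analyticAt_of_differentiableOn_ball (differentiableOn_prod_blaschkeFactor ha F) hz),
      ih, analyticOrderAt_blaschkeFactor (ha j) hz, Finset.filter_insert]
    split_ifs with h
    · rw [Finset.card_insert_of_notMem (by simp [hj]), add_comm]
      norm_cast
    · simp

theorem analyticOrderAt_mul_of_eq_on_ball {f g h : ℂ → ℂ} (hg : DifferentiableOn ℂ g (ball 0 1))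
    (hh : DifferentiableOn ℂ h (ball 0 1)) (hf : ∀ z, ‖z‖ < 1 → f z = g z * h z) {z : ℂ}
    (hz : ‖z‖ < 1) : analyticOrderAt f z = analyticOrderAt g z + analyticOrderAt h z := by
  have : f =ᶠ[𝓝 z] g * h := by
    filter_upwards [isOpen_ball.mem_nhds (mem_ball_zero_iff.mpr hz)] with w hw
    exact hf w (mem_ball_zero_iff.mp hw)
  rw [analyticOrderAt_congr this, analyticOrderAt_mul (analyticAt_of_differentiableOn_ball hg hz)
    (analyticAt_of_differentiableOn_ball hh hz)]

theorem exists_eq_prod_blaschkeFactor_mul {f : ℂ → ℂ} (hf : DifferentiableOn ℂ f (ball 0 1))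
    (hf1 : ∀ z, ‖z‖ < 1 → ‖f z‖ ≤ 1) (ha : ∀ i, ‖a i‖ < 1)
    (hcount : ∀ z, ‖z‖ < 1 → {i | a i = z}.encard = analyticOrderAt f z) (F : Finset ι) :
    ∃ g : ℂ → ℂ, DifferentiableOn ℂ g (ball 0 1) ∧ (∀ z, ‖z‖ < 1 → ‖g z‖ ≤ 1) ∧
      ∀ z, ‖z‖ < 1 → f z = (∏ i ∈ F, blaschkeFactor (a i) z) * g z := by
  classical
  induction F using Finset.induction_on with
  | empty => exact ⟨f, hf, hf1, by simp⟩
  | insert j F hj ih =>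
    obtain ⟨g, hg, hg1, hfg⟩ := ih
    have hg0 : g (a j) = 0 := by
      -- If `g (a j) ≠ 0`, the order of `f` at `a j` is the number of indices in `F` with value `a
      -- j`; but `hcount` also counts `j`, which is not in `F`.
      by_contra h0
      have h1 := analyticOrderAt_mul_of_eq_on_ball (differentiableOn_prod_blaschkeFactor ha F) hg
        hfg (ha j)
      rw [analyticOrderAt_prod_blaschkeFactor ha F (ha j), (analyticAt_of_differentiableOn_ball hg
        (ha j)).analyticOrderAt_eq_zero.mpr h0, add_zero, ← hcount _ (ha j)] at h1
      have h2 : (((insert j F).filter fun i => a i = a j : Finset ι) : Set ι) ⊆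
          {i | a i = a j} := fun i hi => (Finset.mem_filter.mp hi).2
      have h3 := encard_le_encard h2
      rw [h1, encard_coe_eq_coe_finsetCard, Finset.filter_insert, if_pos rfl,
        Finset.card_insert_of_notMem (by simp [hj])] at h3
      have h4 := Nat.cast_le.mp h3
      omega
    obtain ⟨h, hh, hh1, hgh⟩ := exists_eq_blaschkeFactor_mul hg hg1 (ha j) hg0
    refine ⟨h, hh, hh1, fun z hz => ?_⟩
    rw [hfg z hz, hgh z hz, Finset.prod_insert hj]
    ring

theorem norm_le_prod_rho {f : ℂ → ℂ} (hf : DifferentiableOn ℂ f (ball 0 1))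
    (hf1 : ∀ z, ‖z‖ < 1 → ‖f z‖ ≤ 1) (ha : ∀ i, ‖a i‖ < 1)
    (hcount : ∀ z, ‖z‖ < 1 → {i | a i = z}.encard = analyticOrderAt f z) (F : Finset ι)
    {z : ℂ} (hz : ‖z‖ < 1) : ‖f z‖ ≤ ∏ i ∈ F, rho (a i) z := by
  obtain ⟨g, -, hg1, hfg⟩ := exists_eq_prod_blaschkeFactor_mul hf hf1 ha hcount F
  rw [hfg z hz, norm_mul, norm_prod]
  simp only [norm_blaschkeFactor]
  exact mul_le_of_le_one_right (Finset.prod_nonneg fun i _ => rho_nonneg _ _) (hg1 z hz)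

/-- Apply `1 - x ≤ exp (-x)` with `x = 1 - rho ^ 2` to each factor of `∏ rho ^ 2 ≥ η ^ 2`, then take
logarithms. -/
theorem sum_one_sub_rho_sq_le {f : ℂ → ℂ} (hf : DifferentiableOn ℂ f (ball 0 1))
    (hf1 : ∀ z, ‖z‖ < 1 → ‖f z‖ ≤ 1) (ha : ∀ i, ‖a i‖ < 1)
    (hcount : ∀ z, ‖z‖ < 1 → {i | a i = z}.encard = analyticOrderAt f z) (F : Finset ι)
    {z : ℂ} (hz : ‖z‖ < 1) {η : ℝ} (hη : 0 < η) (hfz : η ≤ ‖f z‖) :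
    ∑ i ∈ F, (1 - rho z (a i) ^ 2) ≤ -(2 * Real.log η) := by
  have h1 := hfz.trans (norm_le_prod_rho hf hf1 ha hcount F hz)
  have h2 : η ^ 2 ≤ Real.exp (-∑ i ∈ F, (1 - rho z (a i) ^ 2)) := by
    calc η ^ 2 ≤ (∏ i ∈ F, rho (a i) z) ^ 2 := by gcongr
      _ = ∏ i ∈ F, rho (a i) z ^ 2 := (Finset.prod_pow _ _ _).symm
      _ ≤ ∏ i ∈ F, Real.exp (-(1 - rho z (a i) ^ 2)) := by
        refine Finset.prod_le_prod (fun _ _ => sq_nonneg _) fun i _ => ?_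
        have := Real.add_one_le_exp (-(1 - rho z (a i) ^ 2))
        rw [rho_comm]
        linarith
      _ = _ := by rw [← Real.exp_sum, Finset.sum_neg_distrib]
  have h3 := (Real.log_le_log (by positivity) h2)
  rw [Real.log_exp, Real.log_pow] at h3
  push_cast at h3
  linarith

/-- The quotient `f / b` has meromorphic order `0` everywhere, so its normal form is analytic
without zeros. -/
theorem exists_eq_mul_of_analyticOrderAt_eq {f b : ℂ → ℂ} {V : Set ℂ}
    (hf : AnalyticOnNhd ℂ f V) (hb : AnalyticOnNhd ℂ b V)
    (h : ∀ z ∈ V, analyticOrderAt b z = analyticOrderAt f z)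
    (hfin : ∀ z ∈ V, analyticOrderAt f z ≠ ⊤) :
    ∃ S : ℂ → ℂ, AnalyticOnNhd ℂ S V ∧ (∀ z ∈ V, S z ≠ 0) ∧ ∀ z ∈ V, f z = b z * S z := by
  have hm : MeromorphicOn (f / b) V := fun z hz =>
    (hf z hz).meromorphicAt.div (hb z hz).meromorphicAt
  have hNF := meromorphicNFOn_toMeromorphicNFOn (f / b) V
  have hord : ∀ z ∈ V, meromorphicOrderAt (toMeromorphicNFOn (f / b) V) z = 0 := fun z hz => by
    rw [meromorphicOrderAt_toMeromorphicNFOn hm hz, meromorphicOrderAt_div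
      (hf z hz).meromorphicAt (hb z hz).meromorphicAt, (hf z hz).meromorphicOrderAt_eq,
      (hb z hz).meromorphicOrderAt_eq, h z hz]
    lift analyticOrderAt f z to ℕ using hfin z hz with n
    rw [ENat.map_natCast]
    norm_cast
    simp
  have hS : AnalyticOnNhd ℂ (toMeromorphicNFOn (f / b) V) V := fun z hz =>
    (hNF hz).meromorphicOrderAt_nonneg_iff_analyticAt.mp (hord z hz).ge
  refine ⟨_, hS, fun z hz => (hNF hz).meromorphicOrderAt_eq_zero_iff.mp (hord z hz),
    fun z hz => ?_⟩
  have hb0 : ∀ᶠ w in 𝓝[≠] z, b w ≠ 0 := by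
    refine (hb z hz).eventually_eq_zero_or_eventually_ne_zero.resolve_left fun h0 => ?_
    exact hfin z hz ((h z hz).symm.trans (analyticOrderAt_eq_top.mpr h0))
  have heq : f =ᶠ[𝓝[≠] z] fun w => b w * toMeromorphicNFOn (f / b) V w := by
    filter_upwards [hb0, hm.toMeromorphicNFOn_eq_self_on_nhdsNE hz] with w hw hw2
    rw [hw2, Pi.div_apply, mul_div_cancel₀ _ hw]
  exact tendsto_nhds_unique ((hf z hz).continuousAt.tendsto.mono_left nhdsWithin_le_nhds)
    ((((hb z hz).mul (hS z hz)).continuousAt.tendsto.mono_left nhdsWithin_le_nhds).congr'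
      heq.symm)

/-- The factorization of a bounded analytic function as a Blaschke product times a function
without zeros. -/
theorem exists_eq_tprod_blaschkeFactor_mul {f : ℂ → ℂ} (hf : DifferentiableOn ℂ f (ball 0 1))
    (hf1 : ∀ z, ‖z‖ < 1 → ‖f z‖ ≤ 1) (ha : ∀ i, ‖a i‖ < 1)
    (hcount : ∀ z, ‖z‖ < 1 → {i | a i = z}.encard = analyticOrderAt f z)
    (hfin : ∀ z, ‖z‖ < 1 → analyticOrderAt f z ≠ ⊤) (hs : Summable fun i => 1 - ‖a i‖) :
    ∃ S : ℂ → ℂ, DifferentiableOn ℂ S (ball 0 1) ∧ (∀ z, ‖z‖ < 1 → S z ≠ 0) ∧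
      (∀ z, ‖z‖ < 1 → ‖S z‖ ≤ 1) ∧
      ∀ z, ‖z‖ < 1 → f z = (∏' i, blaschkeFactor (a i) z) * S z := by
  classical
  have hb := differentiableOn_tprod_blaschkeFactor ha hs
  have hord : ∀ z, ‖z‖ < 1 →
      analyticOrderAt (fun z => ∏' i, blaschkeFactor (a i) z) z = analyticOrderAt f z :=
    fun z hz => by
    -- The finitely many factors vanishing at `z` carry the whole order; the remaining product is
    -- nonzero there.
    have hF : {i | a i = z}.Finite := by
      rw [← encard_ne_top_iff, hcount z hz]
      exact hfin z hz
    have ha' : ∀ i : {i // i ∉ hF.toFinset}, ‖a i‖ < 1 := fun i => ha i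
    have hs' : Summable fun i : {i // i ∉ hF.toFinset} => 1 - ‖a i‖ := hs.subtype _
    have hd := differentiableOn_tprod_blaschkeFactor ha' hs'
    rw [analyticOrderAt_mul_of_eq_on_ball (differentiableOn_prod_blaschkeFactor ha hF.toFinset)
      hd (fun w hw => (prod_mul_tprod_blaschkeFactor ha hs hw hF.toFinset).symm) hz,
      (analyticAt_of_differentiableOn_ball hd hz).analyticOrderAt_eq_zero.mpr
        (tprod_blaschkeFactor_ne_zero ha' hs' hz fun i => by simpa using i.2),
      analyticOrderAt_prod_blaschkeFactor ha _ hz, add_zero, ← hcount z hz,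
      hF.encard_eq_coe_toFinset_card, Finset.filter_true_of_mem fun i hi => by simpa using hi]
  obtain ⟨S, hS, hS0, hfS⟩ := exists_eq_mul_of_analyticOrderAt_eq
    (hf.analyticOnNhd isOpen_ball) (hb.analyticOnNhd isOpen_ball)
    (fun z hz => hord z (mem_ball_zero_iff.mp hz)) (fun z hz => hfin z (mem_ball_zero_iff.mp hz))
  simp only [mem_ball_zero_iff] at hS0 hfS
  refine ⟨S, hS.differentiableOn, hS0, fun z hz => ?_, hfS⟩
  refine norm_le_of_eventually_nhdsNE (hS z (mem_ball_zero_iff.mpr hz)).continuousAt ?_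
  have hb0 : ∀ᶠ w in 𝓝[≠] z, ∏' i, blaschkeFactor (a i) w ≠ 0 := by
    refine (analyticAt_of_differentiableOn_ball hb
      hz).eventually_eq_zero_or_eventually_ne_zero.resolve_left fun h0 => ?_
    exact hfin z hz ((hord z hz).symm.trans (analyticOrderAt_eq_top.mpr h0))
  have hball : ∀ᶠ w in 𝓝[≠] z, w ∈ ball (0 : ℂ) 1 :=
    nhdsWithin_le_nhds (isOpen_ball.mem_nhds (mem_ball_zero_iff.mpr hz))
  filter_upwards [hb0, hball] with w hw0 hw
  have hw' := mem_ball_zero_iff.mp hw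
  have h1 : ‖f w‖ ≤ ‖∏' i, blaschkeFactor (a i) w‖ :=
    le_norm_tprod_blaschkeFactor ha hs hw' fun F => norm_le_prod_rho hf hf1 ha hcount F hw'
  rw [hfS w hw', norm_mul] at h1
  exact le_of_mul_le_mul_left (by rwa [mul_one]) (norm_pos_iff.mpr hw0)

end Factorization

/-- Each point of the disc is indexed as often as its order; points that are not zeros contribute
the empty `Fin 0`. -/
theorem exists_zero_enumeration {f : ℂ → ℂ} (hfin : ∀ z, ‖z‖ < 1 → analyticOrderAt f z ≠ ⊤) :
    ∃ (ι : Type) (a : ι → ℂ), (∀ i, ‖a i‖ < 1) ∧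
      ∀ z, ‖z‖ < 1 → {i | a i = z}.encard = analyticOrderAt f z := by
  refine ⟨Σ z : ball (0 : ℂ) 1, Fin (analyticOrderNatAt f z), fun i => i.1,
    fun i => mem_ball_zero_iff.mp i.1.2, fun z hz => ?_⟩
  have e : {i : Σ z : ball (0 : ℂ) 1, Fin (analyticOrderNatAt f z) | (i.1 : ℂ) = z} =
      Sigma.mk (⟨z, mem_ball_zero_iff.mpr hz⟩ : ball (0 : ℂ) 1) '' univ := by
    ext ⟨⟨w, hw⟩, k⟩
    simp only [mem_ofPred_eq, image_univ, mem_range]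
    constructor
    · rintro rfl
      exact ⟨k, rfl⟩
    · rintro ⟨k, h⟩
      exact congrArg (fun i => (i.1 : ℂ)) h.symm
  rw [e, sigma_mk_injective.encard_image, encard_univ, ENat.card_eq_coe_fintype_card,
    Fintype.card_fin]
  exact Nat.cast_analyticOrderNatAt (hfin z hz)

/-! ### Zero-free functions: Harnack and radial limits -/

theorem exists_eq_exp_of_ne_zero {S : ℂ → ℂ} (hS : DifferentiableOn ℂ S (ball 0 1))
    (hS0 : ∀ z, ‖z‖ < 1 → S z ≠ 0) :
    ∃ g : ℂ → ℂ, DifferentiableOn ℂ g (ball 0 1) ∧ ∀ z, ‖z‖ < 1 → S z = Complex.exp (g z) := by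
  have h0 : S 0 ≠ 0 := hS0 0 (by simp)
  have hd : DifferentiableOn ℂ (fun z => deriv S z / S z) (ball 0 1) :=
    (hS.deriv isOpen_ball).div hS fun z hz => hS0 z (mem_ball_zero_iff.mp hz)
  obtain ⟨g, hg0, hg⟩ := hd.isExactOn_ball.with_val_at 0 (Complex.log (S 0))
  refine ⟨g, fun z hz => (hg z hz).differentiableAt.differentiableWithinAt, fun z hz => ?_⟩
  have hderiv : ∀ w ∈ ball (0 : ℂ) 1, HasDerivAt (fun w => S w * Complex.exp (-g w)) 0 w :=
    fun w hw => by
    have h1 := (hS.differentiableAt (isOpen_ball.mem_nhds hw)).hasDerivAt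
    have h2 := hS0 w (mem_ball_zero_iff.mp hw)
    refine (h1.mul (hg w hw).neg.cexp).congr_deriv ?_
    field_simp
    ring
  have hconst := isOpen_ball.is_const_of_deriv_eq_zero (convex_ball (0 : ℂ) 1).isPreconnected
    (fun w hw => (hderiv w hw).differentiableAt.differentiableWithinAt)
    (fun w hw => (hderiv w hw).deriv) (mem_ball_zero_iff.mpr hz) (mem_ball_self one_pos)
  simp only [hg0, Complex.exp_neg, Complex.exp_log h0, mul_inv_cancel₀ h0] at hconst
  rwa [← div_eq_mul_inv, div_eq_one_iff_eq (Complex.exp_ne_zero _)] at hconst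

theorem norm_sub_sq_eq_re_im (A B : ℂ) :
    ‖A - B‖ ^ 2 = (A.re - B.re) ^ 2 + (A.im - B.im) ^ 2 := by
  rw [← Complex.normSq_eq_norm_sq, Complex.normSq_apply]
  simp
  ring

theorem norm_add_conj_sq_eq_re_im (A B : ℂ) :
    ‖A + conj B‖ ^ 2 = (A.re + B.re) ^ 2 + (A.im - B.im) ^ 2 := by
  rw [← Complex.normSq_eq_norm_sq, Complex.normSq_apply]
  simp
  ring

/-- Harnack's inequality for the real part of an analytic function. -/
theorem re_mul_one_sub_le {g : ℂ → ℂ} (hg : DifferentiableOn ℂ g (ball 0 1))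
    (hre : ∀ z, ‖z‖ < 1 → 0 < (g z).re) {z w : ℂ} (hz : ‖z‖ < 1) (hw : ‖w‖ < 1) {t : ℝ}
    (ht : t ≤ 1) (h : rho z w ≤ t) : (g z).re * (1 - t) ≤ (g w).re * (1 + t) := by
  have hne : ∀ ζ, ‖ζ‖ < 1 → g ζ + conj (g w) ≠ 0 := fun ζ hζ h0 => by
    have := congrArg Complex.re h0
    simp only [Complex.add_re, Complex.conj_re, Complex.zero_re] at this
    linarith [hre ζ hζ, hre w hw]
  -- This Cayley transform maps the right half-plane to the disc and `g w` to `0`, so Schwarz-Pick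
  -- applies.
  have hq : DifferentiableOn ℂ (fun ζ => (g ζ - g w) / (g ζ + conj (g w))) (ball 0 1) :=
    (hg.sub_const _).div (hg.add_const _) fun ζ hζ => hne ζ (mem_ball_zero_iff.mp hζ)
  have hq1 : ∀ ζ ∈ ball (0 : ℂ) 1, ‖(g ζ - g w) / (g ζ + conj (g w))‖ ≤ 1 := fun ζ hζ => by
    rw [norm_div]
    refine div_le_one_of_le₀ ?_ (norm_nonneg _)
    rw [← sq_le_sq₀ (norm_nonneg _) (norm_nonneg _), norm_sub_sq_eq_re_im,
      norm_add_conj_sq_eq_re_im]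
    nlinarith [mul_pos (hre ζ (mem_ball_zero_iff.mp hζ)) (hre w hw)]
  have h1 := (norm_le_rho_of_eq_zero hq hq1 hw hz (by simp)).trans (rho_comm z w ▸ h)
  have ht0 : 0 ≤ t := (rho_nonneg z w).trans h
  rw [norm_div, div_le_iff₀ (norm_pos_iff.mpr (hne z hz)),
    ← sq_le_sq₀ (norm_nonneg _) (by positivity), mul_pow, norm_sub_sq_eq_re_im,
    norm_add_conj_sq_eq_re_im] at h1
  have hx := hre z hz
  have hy := hre w hw
  have h2 : ((g z).re - (g w).re) ^ 2 ≤ (t * ((g z).re + (g w).re)) ^ 2 := by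
    have : t ^ 2 ≤ 1 := by nlinarith
    nlinarith [sq_nonneg ((g z).im - (g w).im)]
  have h3 := abs_le_of_sq_le_sq h2 (by positivity)
  linarith [(abs_le.mp h3).2]

/-- Harnack's inequality for the positive harmonic function `1 - log ‖S‖`; the added `1` keeps it
strictly positive even where `‖S‖ = 1`. -/
theorem exists_pos_le_norm {S : ℂ → ℂ} (hS : DifferentiableOn ℂ S (ball 0 1))
    (hS0 : ∀ z, ‖z‖ < 1 → S z ≠ 0) (hS1 : ∀ z, ‖z‖ < 1 → ‖S z‖ ≤ 1) {t η : ℝ} (ht : t < 1)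
    (hη : 0 < η) (h : ∀ z, ‖z‖ < 1 → ∃ w, ‖w‖ < 1 ∧ rho z w ≤ t ∧ η ≤ ‖S w‖) :
    ∃ c : ℝ, 0 < c ∧ ∀ z, ‖z‖ < 1 → c ≤ ‖S z‖ := by
  obtain ⟨g, hg, hSg⟩ := exists_eq_exp_of_ne_zero hS hS0
  have hnorm : ∀ z, ‖z‖ < 1 → ‖S z‖ = Real.exp (g z).re := fun z hz => by
    rw [hSg z hz, Complex.norm_exp]
  have hre : ∀ z, ‖z‖ < 1 → 0 < (1 - g z).re := fun z hz => by
    have := hS1 z hz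
    rw [hnorm z hz, Real.exp_le_one_iff] at this
    simp only [Complex.sub_re, Complex.one_re]
    linarith
  refine ⟨Real.exp (-((1 - Real.log η) * (1 + t) / (1 - t))), Real.exp_pos _, fun z hz => ?_⟩
  obtain ⟨w, hw, hzw, hηw⟩ := h z hz
  have ht0 : 0 ≤ t := (rho_nonneg z w).trans hzw
  have h1 := re_mul_one_sub_le (g := fun z => 1 - g z) (hg.const_sub 1) hre hz hw ht.le hzw
  simp only [Complex.sub_re, Complex.one_re] at h1
  rw [hnorm w hw, ← Real.log_le_iff_le_exp hη] at hηw
  rw [hnorm z hz]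
  gcongr
  rw [neg_le, le_div_iff₀ (by linarith)]
  nlinarith

/-- A zero-free inner function that is bounded below is constant. -/
theorem exists_const_of_radial_norm_tendsto_one {S : ℂ → ℂ}
    (hS : DifferentiableOn ℂ S (ball 0 1)) (hS1 : ∀ z, ‖z‖ < 1 → ‖S z‖ ≤ 1) {c : ℝ}
    (hc : 0 < c) (hcS : ∀ z, ‖z‖ < 1 → c ≤ ‖S z‖)
    (hrad : ∀ᵐ θ : ℝ, Tendsto (fun r : ℝ => ‖S (r * Complex.exp (θ * Complex.I))‖)
      (𝓝[<] 1) (𝓝 1)) : ∃ k : ℂ, ‖k‖ = 1 ∧ ∀ z, ‖z‖ < 1 → S z = k := by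
  have hS0 : ∀ z, ‖z‖ < 1 → S z ≠ 0 := fun z hz => norm_pos_iff.mp (hc.trans_le (hcS z hz))
  -- The bound `c⁻¹` on `1 / S` allows dominated convergence: its circle means of modulus tend to
  -- `1`, so `‖S 0‖ ≥ 1` and `‖S‖` has an interior maximum.
  have hT : DifferentiableOn ℂ (fun z => (S z)⁻¹) (ball 0 1) :=
    hS.inv fun z hz => hS0 z (mem_ball_zero_iff.mp hz)
  have hr : ∀ᶠ r : ℝ in 𝓝[<] 1, r ∈ Ioo (0 : ℝ) 1 := Ioo_mem_nhdsLT one_pos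
  have hcirc : ∀ r ∈ Ioo (0 : ℝ) 1, ∀ θ : ℝ, ‖circleMap 0 r θ‖ < 1 := fun r hr θ => by
    rw [norm_circleMap_zero, abs_of_pos hr.1]
    exact hr.2
  have hcont : ∀ r ∈ Ioo (0 : ℝ) 1, Continuous fun θ : ℝ => ‖(S (circleMap 0 r θ))⁻¹‖ :=
    fun r hr => (hT.continuousOn.comp_continuous (continuous_circleMap 0 r)
      fun θ => mem_ball_zero_iff.mpr (hcirc r hr θ)).norm
  have hlim : Tendsto (fun r : ℝ => ∫ θ in (0 : ℝ)..2 * Real.pi, ‖(S (circleMap 0 r θ))⁻¹‖)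
      (𝓝[<] 1) (𝓝 (∫ _ in (0 : ℝ)..2 * Real.pi, (1 : ℝ))) := by
    refine intervalIntegral.tendsto_integral_filter_of_dominated_convergence (fun _ => c⁻¹)
      ?_ ?_ intervalIntegrable_const ?_
    · filter_upwards [hr] with r hr using (hcont r hr).aestronglyMeasurable
    · filter_upwards [hr] with r hr
      refine Eventually.of_forall fun θ _ => ?_
      rw [norm_norm, norm_inv]
      exact inv_anti₀ hc (hcS _ (hcirc r hr θ))
    · filter_upwards [hrad] with θ hθ _
      have := hθ.inv₀ one_ne_zero
      simpa [circleMap] using this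
  have hmean : ∀ r ∈ Ioo (0 : ℝ) 1, ‖(S 0)⁻¹‖ ≤
      (2 * Real.pi)⁻¹ * ∫ θ in (0 : ℝ)..2 * Real.pi, ‖(S (circleMap 0 r θ))⁻¹‖ := fun r hr => by
    have hd : DiffContOnCl ℂ (fun z => (S z)⁻¹) (ball 0 |r|) := by
      refine (hT.mono ?_).diffContOnCl
      rw [abs_of_pos hr.1]
      exact closure_ball_subset_closedBall.trans (closedBall_subset_ball hr.2)
    have h1 : Real.circleAverage (fun z => (S z)⁻¹) 0 r = (S 0)⁻¹ := hd.circleAverage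
    rw [← h1, Real.circleAverage_def, norm_smul, Real.norm_of_nonneg (by positivity)]
    gcongr
    exact intervalIntegral.norm_integral_le_integral_norm Real.two_pi_pos.le
  have h0 : ‖(S 0)⁻¹‖ ≤ 1 := by
    refine ge_of_tendsto ?_ (hr.mono hmean)
    have := hlim.const_mul (2 * Real.pi)⁻¹
    rwa [intervalIntegral.integral_const, sub_zero, smul_eq_mul, mul_one,
      inv_mul_cancel₀ Real.two_pi_pos.ne'] at this
  have hS01 : ‖S 0‖ = 1 := by
    refine le_antisymm (hS1 0 (by simp)) ?_
    rw [norm_inv] at h0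
    exact (inv_le_one₀ (norm_pos_iff.mpr (hS0 0 (by simp)))).mp h0
  refine ⟨S 0, hS01, fun z hz => ?_⟩
  refine Complex.eqOn_of_isPreconnected_of_isMaxOn_norm (convex_ball (0 : ℂ) 1).isPreconnected
    isOpen_ball hS (mem_ball_self one_pos) (fun w hw => ?_) (mem_ball_zero_iff.mpr hz)
  simpa [hS01] using hS1 w (mem_ball_zero_iff.mp hw)

/-! ### Splitting the zeros into separated families -/

/-- A countable graph in which every vertex has fewer than `N` neighbours has a proper colouring
with `N` colours. -/
theorem exists_coloring {ι : Type*} [Countable ι] (R : ι → ι → Prop) (hR : ∀ i j, R i j → R j i)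
    (N : ℕ) (hN : ∀ j, ∀ F : Finset ι, (∀ k ∈ F, R j k) → F.card < N) :
    ∃ col : ι → Fin N, ∀ i j, i ≠ j → R i j → col i ≠ col j := by
  classical
  rcases isEmpty_or_nonempty ι with he | ⟨⟨i0⟩⟩
  · exact ⟨fun i => he.elim i, fun i => he.elim i⟩
  have hN0 : NeZero N := ⟨(hN i0 ∅ (by simp)).ne_bot⟩
  obtain ⟨e, he⟩ := exists_injective_nat ι
  -- Greedy colouring along `e`: avoid the colours of earlier neighbours. The default `0` never
  -- occurs, since a vertex with all colours blocked would have `N` distinct neighbours.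
  let step : (j : ι) → ((k : ι) → e k < e j → Fin N) → Fin N := fun j prev =>
    if h : ∃ c, ∀ k hk, R j k → prev k hk ≠ c then h.choose else 0
  let col : ι → Fin N := (measure e).wf.fix step
  have key : ∀ j k, e k < e j → R j k → col k ≠ col j := fun j => by
    have h : ∃ c, ∀ k, e k < e j → R j k → col k ≠ c := by
      by_contra! hc
      choose g hg1 hg2 hg3 using hc
      have hinj : Function.Injective g := fun c d hcd => by rw [← hg3 c, ← hg3 d, hcd]
      have h1 := hN j (Finset.univ.map ⟨g, hinj⟩) fun k hk => by
        obtain ⟨c, -, rfl⟩ := Finset.mem_map.mp hk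
        exact hg2 c
      simp at h1
    have h2 : col j = h.choose := by
      have : col j = step j fun k _ => col k := (measure e).wf.fix_eq step j
      rw [this]
      exact dif_pos h
    rw [h2]
    exact h.choose_spec
  refine ⟨col, fun i j hij hRij => ?_⟩
  rcases lt_or_gt_of_ne (he.ne hij) with h | h
  · exact key j i h (hR i j hRij)
  · exact (key i j h hRij).symm

theorem exists_separated_coloring {ι : Type*} {a : ι → ℂ} (ha : ∀ i, ‖a i‖ < 1)
    (hs : Summable fun i => 1 - ‖a i‖) {M : ℝ}
    (hM : ∀ j, ∀ F : Finset ι, ∑ k ∈ F, (1 - rho (a j) (a k) ^ 2) ≤ M) :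
    ∃ (N : ℕ) (col : ι → Fin N), ∀ i j, i ≠ j → col i = col j → 1 / 2 ≤ rho (a i) (a j) := by
  have hcount : Countable ι := by
    rw [← countable_univ_iff]
    refine hs.countable_support.mono fun i _ => ?_
    rw [Function.mem_support]
    linarith [ha i]
  -- An index with `rho < 1 / 2` adds more than `3 / 4` to a sum bounded by `M`, so there are at
  -- most `4 / 3 * M` of them.
  obtain ⟨col, hcol⟩ := exists_coloring (fun i j => rho (a i) (a j) < 1 / 2)
    (fun i j h => by rwa [rho_comm]) (⌊4 / 3 * M⌋₊ + 1) fun j F hF => by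
      have h1 : ∑ _k ∈ F, (3 / 4 : ℝ) ≤ ∑ k ∈ F, (1 - rho (a j) (a k) ^ 2) :=
        Finset.sum_le_sum fun k hk => by nlinarith [hF k hk, rho_nonneg (a j) (a k)]
      have h2 := h1.trans (hM j F)
      rw [Finset.sum_const, nsmul_eq_mul] at h2
      have h3 := Nat.lt_floor_add_one (4 / 3 * M)
      have h4 : (F.card : ℝ) < ((⌊4 / 3 * M⌋₊ + 1 : ℕ) : ℝ) := by
        push_cast
        linarith
      exact_mod_cast h4
  refine ⟨_, col, fun i j hij h => ?_⟩
  by_contra! hlt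
  exact hcol i j hij hlt h

theorem isInterpolatingBlaschkeProduct_const {k : ℂ} (hk : ‖k‖ = 1) :
    IsInterpolatingBlaschkeProduct fun _ => k := by
  refine ⟨∅, ⟨empty_subset _, ?_, k, hk, fun z _ => ⟨?_, ?_⟩⟩, fun v _ => ?_⟩
  · exact (hasSum_empty).summable
  · exact (hasProd_empty).multipliable
  · rw [tprod_empty, mul_one]
  · exact ⟨0, ⟨differentiableOn_const _, 0, by simp⟩, fun a => a.2.elim⟩

theorem isInterpolatingBlaschkeProduct_of_separated {ι : Type*} {a : ι → ℂ}
    (ha : ∀ i, ‖a i‖ < 1) (hs : Summable fun i => 1 - ‖a i‖) {M : ℝ}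
    (hM : ∀ j, ∀ F : Finset ι, ∑ k ∈ F, (1 - rho (a j) (a k) ^ 2) ≤ M)
    (hsep : ∀ i j, i ≠ j → 1 / 2 ≤ rho (a i) (a j)) :
    IsInterpolatingBlaschkeProduct fun z => ∏' i, blaschkeFactor (a i) z := by
  have hinj : Function.Injective a := fun i j hij => by
    by_contra hne
    have := hsep i j hne
    rw [(rho_eq_zero_iff (ha i) (ha j)).mpr hij] at this
    norm_num at this
  let e : ι ≃ range a := Equiv.ofInjective a hinj
  refine ⟨range a, ⟨?_, ?_, 1, norm_one, fun z hz => ⟨?_, ?_⟩⟩, fun v ⟨C, hC⟩ => ?_⟩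
  · rintro _ ⟨i, rfl⟩
    exact mem_ball_zero_iff.mpr (ha i)
  · exact e.summable_iff.mp hs
  · exact e.multipliable_iff.mp (multipliable_blaschkeFactor ha hs (mem_ball_zero_iff.mp hz))
  · rw [one_mul]
    exact e.tprod_eq fun b : range a => blaschkeFactor b z
  · obtain ⟨f, hf, hfv⟩ := exists_isHInfty_interpolating ha hs hM hsep (fun i => v (e i))
      fun i => hC (e i)
    refine ⟨f, hf, ?_⟩
    rintro ⟨_, i, rfl⟩
    exact hfv i

/-! ### The Carleson-Newman criterion and the Frostman shift -/

/-- A bounded analytic function with radial limits of modulus `1` almost everywhere, and which is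
bounded below somewhere in each hyperbolic disc of a fixed radius, is a Carleson-Newman Blaschke
product. -/
theorem isCarlesonNewmanBlaschkeProduct_of_exists_le_norm {f : ℂ → ℂ}
    (hf : DifferentiableOn ℂ f (ball 0 1)) (hf1 : ∀ z, ‖z‖ < 1 → ‖f z‖ ≤ 1)
    (hrad : ∀ᵐ θ : ℝ, Tendsto (fun r : ℝ => ‖f (r * Complex.exp (θ * Complex.I))‖)
      (𝓝[<] 1) (𝓝 1)) {t η : ℝ} (ht : t < 1) (hη : 0 < η)
    (h : ∀ z, ‖z‖ < 1 → ∃ w, ‖w‖ < 1 ∧ rho z w ≤ t ∧ η ≤ ‖f w‖) :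
    IsCarlesonNewmanBlaschkeProduct f := by
  have hfin : ∀ z, ‖z‖ < 1 → analyticOrderAt f z ≠ ⊤ := fun z hz => by
    obtain ⟨w, hw, -, hfw⟩ := h z hz
    refine (hf.analyticOnNhd isOpen_ball).analyticOrderAt_ne_top_of_isPreconnected
      (convex_ball (0 : ℂ) 1).isPreconnected (mem_ball_zero_iff.mpr hw)
      (mem_ball_zero_iff.mpr hz) ?_
    rw [(analyticAt_of_differentiableOn_ball hf hw).analyticOrderAt_eq_zero.mpr
      (norm_pos_iff.mp (hη.trans_le hfw))]
    exact ENat.zero_ne_top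
  obtain ⟨ι, a, ha, hcount⟩ := exists_zero_enumeration hfin
  have ht0 : 0 ≤ t := by
    obtain ⟨w, -, hw, -⟩ := h 0 (by simp)
    exact (rho_nonneg _ _).trans hw
  obtain ⟨K, hK, hKle⟩ := exists_one_sub_rho_sq_le ht0 ht
  have hM : ∀ z, ‖z‖ < 1 → ∀ F : Finset ι,
      ∑ i ∈ F, (1 - rho z (a i) ^ 2) ≤ K * -(2 * Real.log η) := fun z hz F => by
    obtain ⟨w, hw, hzw, hfw⟩ := h z hz
    calc ∑ i ∈ F, (1 - rho z (a i) ^ 2) ≤ ∑ i ∈ F, K * (1 - rho w (a i) ^ 2) :=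
          Finset.sum_le_sum fun i _ => hKle z w (a i) hz hw (ha i) hzw
      _ ≤ _ := by
          rw [← Finset.mul_sum]
          gcongr
          exact sum_one_sub_rho_sq_le hf hf1 ha hcount F hw hη hfw
  have hs : Summable fun i => 1 - ‖a i‖ := by
    refine summable_of_sum_le (fun i => sub_nonneg.mpr (ha i).le) fun F =>
      (Finset.sum_le_sum fun i _ => ?_).trans (hM 0 (by simp) F)
    have : rho 0 (a i) = ‖a i‖ := by simp [rho]
    rw [this]
    nlinarith [ha i, norm_nonneg (a i)]
  obtain ⟨S, hS, hS0, hS1, hfS⟩ := exists_eq_tprod_blaschkeFactor_mul hf hf1 ha hcount hfin hs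
  have hfS' : ∀ z, ‖z‖ < 1 → ‖f z‖ ≤ ‖S z‖ := fun z hz => by
    rw [hfS z hz, norm_mul]
    exact mul_le_of_le_one_left (norm_nonneg _) (norm_tprod_blaschkeFactor_le_one ha hs hz)
  obtain ⟨c, hc, hcS⟩ := exists_pos_le_norm hS hS0 hS1 ht hη fun z hz => by
    obtain ⟨w, hw, hzw, hfw⟩ := h z hz
    exact ⟨w, hw, hzw, hfw.trans (hfS' w hw)⟩
  obtain ⟨k, hk, hSk⟩ := exists_const_of_radial_norm_tendsto_one hS hS1 hc hcS <| by
    filter_upwards [hrad] with θ hθ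
    have hball : ∀ᶠ r : ℝ in 𝓝[<] 1, ‖(r * Complex.exp (θ * Complex.I) : ℂ)‖ < 1 := by
      filter_upwards [Ioo_mem_nhdsLT (zero_lt_one' ℝ)] with r hr
      rw [norm_mul, Complex.norm_exp_ofReal_mul_I, mul_one, Complex.norm_real,
        Real.norm_of_nonneg hr.1.le]
      exact hr.2
    exact tendsto_of_tendsto_of_tendsto_of_le_of_le' hθ tendsto_const_nhds
      (hball.mono fun r hr => hfS' _ hr) (hball.mono fun r hr => hS1 _ hr)
  obtain ⟨N, col, hcol⟩ := exists_separated_coloring ha hs fun j => hM (a j) (ha j)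
  -- The extra factor is the unimodular constant `k`, an interpolating Blaschke product without
  -- zeros.
  refine ⟨N + 1, Fin.cons (fun _ => k) fun i z => ∏' x : {x // col x = i}, blaschkeFactor (a x) z,
    fun i => ?_, fun z hz => ?_⟩
  · refine Fin.cases ?_ (fun i => ?_) i
    · exact isInterpolatingBlaschkeProduct_const hk
    · refine isInterpolatingBlaschkeProduct_of_separated (fun x : {x // col x = i} => ha x)
        (hs.subtype _) (M := K * -(2 * Real.log η)) (fun x F => ?_) fun x y hxy =>
          hcol x y (Subtype.coe_ne_coe.mpr hxy) (x.2.trans y.2.symm)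
      have := hM (a x) (ha x) (F.map (Function.Embedding.subtype _))
      simpa [Finset.sum_map] using this
  · have hz' := mem_ball_zero_iff.mp hz
    have h1 := (Equiv.sigmaFiberEquiv col).hasProd_iff.mpr
      (multipliable_blaschkeFactor ha hs hz').hasProd
    have h2 := h1.sigma fun i => (multipliable_blaschkeFactor
      (a := fun x : {x // col x = i} => a x) (fun x => ha x) (hs.subtype _) hz').hasProd
    rw [Fin.prod_univ_succ, hfS z hz', hSk z hz', mul_comm]
    simp only [Fin.cons_zero, Fin.cons_succ]
    rw [h2.unique (hasProd_fintype _)]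

theorem isCarlesonNewmanBlaschkeProduct_phi_comp {U : ℂ → ℂ} (hU : IsInner U) {ψ : ℝ → ℝ}
    (hψ : IsLowerBound U ψ) {γ : ℂ} (hγ_pos : 0 < ‖γ‖)
    (hγ_lt : ‖γ‖ < sSup (ψ '' Ioo (0 : ℝ) 1)) :
    IsCarlesonNewmanBlaschkeProduct fun z => phi γ (U z) := by
  obtain ⟨_, ⟨t, ht, rfl⟩, hγt⟩ := exists_lt_of_lt_csSup
    ((nonempty_Ioo.mpr (zero_lt_one' ℝ)).image ψ) hγ_lt
  have hγ : ‖γ‖ < 1 := hγt.trans (hψ.mapsTo ht).2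
  have hU1 : ∀ z, ‖z‖ < 1 → ‖U z‖ ≤ 1 := fun z hz =>
    hU.norm_le_one z (mem_ball_zero_iff.mpr hz)
  refine isCarlesonNewmanBlaschkeProduct_of_exists_le_norm (t := t)
    -- The value `‖γ‖` is attained at zeros of `U`. The other bound holds where `‖U‖ ≥ ψ t`: the
    -- numerator of `phi` is at least `ψ t - ‖γ‖`, the denominator at most `2`.
    (η := min ‖γ‖ ((ψ t - ‖γ‖) / 2))
    ((differentiableOn_phi hγ).comp hU.differentiableOn fun z hz =>
      mem_closedBall_zero_iff.mpr (hU.norm_le_one z hz))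
    (fun z hz => norm_phi_le_one hγ (hU1 z hz)) ?_ ht.2 (lt_min hγ_pos (by linarith)) ?_
  · filter_upwards [hU.radial_limit] with θ ⟨l, hl, hlim⟩
    have hden : 1 - l * conj γ ≠ 0 := by
      rw [mul_comm]
      exact one_sub_conj_mul_ne_zero hγ hl.le
    have h1 : ContinuousAt (phi γ) l := by
      unfold phi
      fun_prop (disch := exact hden)
    have h2 := (h1.tendsto.comp hlim).norm
    rwa [norm_phi_eq_one hγ hl] at h2
  · intro z hz
    have hlarge : ψ t ≤ ‖U z‖ → ∃ w, ‖w‖ < 1 ∧ rho z w ≤ t ∧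
        min ‖γ‖ ((ψ t - ‖γ‖) / 2) ≤ ‖phi γ (U w)‖ := fun hle => by
      refine ⟨z, hz, ?_, min_le_of_right_le ?_⟩
      · rw [(rho_eq_zero_iff hz hz).mpr rfl]
        exact ht.1.le
      · have h0 := norm_pos_iff.mpr (one_sub_conj_mul_ne_zero hγ (hU1 z hz))
        have h1 : ψ t - ‖γ‖ ≤ ‖γ - U z‖ := by
          have := norm_sub_norm_le (U z) γ
          rw [norm_sub_rev] at this
          linarith
        have h2 : ‖1 - conj γ * U z‖ ≤ 2 := by
          refine (norm_sub_le _ _).trans ?_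
          rw [norm_one, norm_mul, RCLike.norm_conj]
          nlinarith [hU1 z hz, norm_nonneg (U z)]
        rw [norm_phi, rho]
        gcongr
    rcases (zeroSet U).eq_empty_or_nonempty with hZ | hZ
    · exact hlarge (hψ.le_norm_of_empty hZ z (mem_ball_zero_iff.mpr hz) t ht)
    · rcases lt_or_ge (rhoSet z (zeroSet U)) t with hlt | hge
      · obtain ⟨_, ⟨w, hw, rfl⟩, hwt⟩ := exists_lt_of_csInf_lt (hZ.image _) hlt
        refine ⟨w, mem_ball_zero_iff.mp hw.1, hwt.le, min_le_of_left_le ?_⟩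
        simp [hw.2, phi]
      · obtain ⟨w0, hw0⟩ := hZ
        have hbdd : BddBelow (rho z '' zeroSet U) :=
          ⟨0, by rintro _ ⟨w, -, rfl⟩; exact rho_nonneg z w⟩
        have h1 : rhoSet z (zeroSet U) < 1 :=
          (csInf_le hbdd ⟨w0, hw0, rfl⟩).trans_lt (rho_lt_one hz (mem_ball_zero_iff.mp hw0.1))
        have h0 : 0 < rhoSet z (zeroSet U) := ht.1.trans_le hge
        exact hlarge ((hψ.monotoneOn ht ⟨h0, h1⟩ hge).trans
          (hψ.le_norm ⟨w0, hw0⟩ z (mem_ball_zero_iff.mpr hz) h0))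

end CarlesonNewman

theorem mainTheorem6 (U : ℂ → ℂ) (hU : CarlesonNewman.IsInner U)
    (ψ : ℝ → ℝ) (hψ : CarlesonNewman.IsLowerBound U ψ)
    (γ : ℂ) (hγ_pos : 0 < ‖γ‖) (hγ_lt : ‖γ‖ < sSup (ψ '' Set.Ioo (0 : ℝ) 1)) :
    CarlesonNewman.IsCarlesonNewmanBlaschkeProduct
      (fun z => CarlesonNewman.phi γ (U z)) :=
  CarlesonNewman.isCarlesonNewmanBlaschkeProduct_phi_comp hU hψ hγ_pos hγ_lt
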